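/- Let $\mathbb D\subset\mathbb C$ be the open unit disk. An $N$-function is a continuous, convex, increasing function $\Phi\colon[0,\infty)\to[0,\infty)$ with $\Phi(0)=0$, $\lim_{t\to0^+}\Phi(t)/t=0$ and $\lim_{t\to\infty}\Phi(t)/t=\infty$. It is doubling if there is a constant $C_D\ge2$ with $\Phi(2t)\le C_D\Phi(t)$ for all $t\ge0$. For $p>1$ and $t_0\ge0$, it satisfies $(\mathrm{aInc})_p$ on $t\ge t_0$ if there is a constant $C_A\ge1$ with $$\frac{\Phi(s)}{s^p}\le C_A\frac{\Phi(t)}{t^p}\qquad\text{whenever } t_0\le s\le t,\ s>0 .$$ A homeomorphism $\varphi\colon\partial\mathbb D\to\partial\mathbb D$ satisfies the $\Phi$-Douglas condition if $$\int_{\partial\mathbb D}\int_{\partial\mathbb D}\Phi\left(\left|\frac{\varphi(\xi)-\varphi(\eta)}{\xi-\eta}\right|\right)|d\xi|\,|d\eta|<\infty .$$ Let $W^{1,\Phi}(\mathbb D)$ be the set of all $f$ in the Sobolev space $W^{1,1}(\mathbb D,\mathbb C)$ with $\int_{\mathbb D}\Phi(|Df(x)|)\,dx<\infty$, where $Df$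 is the weak differential of $f$ and $|Df|$ its operator norm. **Theorem.** Let $\varphi\colon\partial\mathbb D\to\partial\mathbb D$ be a homeomorphism of the unit circle onto itself. Let $\Phi$ and $\Psi$ be doubling $N$-functions, each of which satisfies $(\mathrm{aInc})_p$ on $t\ge t_0$ for some $p>1$ and some $t_0\ge0$ (where $p$ and $t_0$ may be different for $\Phi$ and $\Psi$). Then the following are equivalent: 1. $\varphi$ satisfies the $\Phi$-Douglas condition and $\varphi^{-1}$ satisfies the $\Psi$-Douglas condition; 2. there is a homeomorphism $h\colon\overline{\mathbb D}\to\overline{\mathbb D}$ of the closed disk onto itself with $h=\varphi$ on $\partial\mathbb D$, $h\in W^{1,\Phi}(\mathbb D)$ and $h^{-1}\in W^{1,\Psi}(\mathbb D)$. -/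

import Mathlib

open MeasureTheory Set Filter Topology
open scoped NNReal ENNReal

noncomputable section

namespace OrliczSobolev

/-- `Φ : [0, ∞) → [0, ∞)` is an N-function: continuous, convex, increasing, `Φ 0 = 0`,
`Φ t / t → 0` as `t → 0⁺` and `Φ t / t → ∞` as `t → ∞`. -/
structure IsNFunction (Φ : ℝ≥0 → ℝ≥0) : Prop where
  continuous : Continuous Φ
  convex : ConvexOn ℝ≥0 univ Φ
  mono : Monotone Φ
  map_zero : Φ 0 = 0
  tendsto_zero : Tendsto (fun t => Φ t / t) (𝓝[>] 0) (𝓝 0)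
  tendsto_atTop : Tendsto (fun t => Φ t / t) atTop atTop

/-- The doubling condition (Δ₂-condition). -/
def IsDoubling (Φ : ℝ≥0 → ℝ≥0) : Prop :=
  ∃ C : ℝ≥0, 2 ≤ C ∧ ∀ t, Φ (2 * t) ≤ C * Φ t

/-- `Φ` satisfies (aInc)ₚ on `t ≥ t₀`: the function `Φ t / t ^ p` is almost increasing there. -/
def IsAInc (Φ : ℝ≥0 → ℝ≥0) (p : ℝ) (t₀ : ℝ≥0) : Prop :=
  ∃ C : ℝ≥0, 1 ≤ C ∧ ∀ s t : ℝ≥0, t₀ ≤ s → 0 < s → s ≤ t → Φ s / s ^ p ≤ C * (Φ t / t ^ p)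

/-- The `Φ`-Douglas condition for `φ : ∂𝔻 → ℂ`. The integral over `∂𝔻` with respect to arc length
`|dξ|` is taken in the parametrization `ξ = exp (i s)`, `-π < s ≤ π`. -/
def DouglasCondition (Φ : ℝ≥0 → ℝ≥0) (φ : Circle → ℂ) : Prop :=
  ∫⁻ s in Ioc (-Real.pi) Real.pi, ∫⁻ t in Ioc (-Real.pi) Real.pi,
    (Φ ‖(φ (Circle.exp s) - φ (Circle.exp t)) /
      ((Circle.exp s : ℂ) - (Circle.exp t : ℂ))‖₊ : ℝ≥0∞) < ⊤

/-- The integrable map `Df` is a weak (distributional) differential on `Ω ⊆ ℂ = ℝ²` of the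
integrable map `f`. -/
structure HasWeakDifferential (Ω : Set ℂ) (f : ℂ → ℂ) (Df : ℂ → ℂ →L[ℝ] ℂ) : Prop where
  integrableOn : IntegrableOn f Ω
  integrableOn_differential : IntegrableOn Df Ω
  integral_eq : ∀ η : ℂ → ℝ, ContDiff ℝ (⊤ : ℕ∞) η → HasCompactSupport η → tsupport η ⊆ Ω →
    ∀ v : ℂ, ∫ z in Ω, (fderiv ℝ η z v) • f z = -∫ z in Ω, η z • Df z v

/-- `f ∈ W^{1,Φ}(Ω, ℂ)`: `f ∈ W^{1,1}(Ω, ℂ)` and `∫_Ω Φ(|Df|) < ∞`, where `|Df|` is the operator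
norm. -/
def MemW1 (Φ : ℝ≥0 → ℝ≥0) (Ω : Set ℂ) (f : ℂ → ℂ) : Prop :=
  ∃ Df : ℂ → ℂ →L[ℝ] ℂ, HasWeakDifferential Ω f Df ∧
    ∫⁻ z in Ω, (Φ ‖Df z‖₊ : ℝ≥0∞) < ⊤

/-- The open unit disk `𝔻`. -/
abbrev disk : Set ℂ := Metric.ball 0 1

/-- The closed unit disk. -/
abbrev closedDisk : Set ℂ := Metric.closedBall 0 1

/-- A self-map of the closed disk as a function on `ℂ`; it is given the irrelevant value `0`
outside the closed disk. -/
def toFun (h : closedDisk → closedDisk) : ℂ → ℂ :=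
  Function.extend Subtype.val (fun z => (h z : ℂ)) 0

/-- The inclusion of the unit circle in the closed disk. -/
def circleToDisk (ξ : Circle) : closedDisk :=
  ⟨ξ, by rw [mem_closedBall_zero_iff]; exact (Circle.norm_coe ξ).le⟩

/-- `h` extends `φ` : they agree on the unit circle. -/
def Extends (h : closedDisk → closedDisk) (φ : Circle → Circle) : Prop :=
  ∀ ξ : Circle, h (circleToDisk ξ) = circleToDisk (φ ξ)

end OrliczSobolev

end

open MeasureTheory Set Filter Topology
open scoped NNReal ENNReal

noncomputable section

namespace OrliczSobolev

/-! From the boundary to the disk. After a reflection if necessary, `φ` lifts to an increasing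
homeomorphism ψ of the line that commutes with translation by 2π; let χ be its inverse. Put g₁ = (id
+ ψ)/2 and g₂ = (id + χ)/2. Then g₂ ∘ ψ = g₁, and the identity summand makes both maps expand
distances by at least 1/2. Let B_g be the Beurling–Ahlfors extension, whose components are the right
and left means of g at scale y. Expansion of g makes the inverse of B_g 4-Lipschitz
(`IsExpanding.dist_le_dist_beurlingAhlfors`), while near (x, y) the map B_g itself is Lipschitz with
constant comparable to 1 + (g(x+2y) - g(x-2y))/y (`IsExpanding.abs_rightMean_sub_le`). Hence
B_{g₂}⁻¹ ∘ B_{g₁} has boundary values ψ and is controlled by difference quotients of ψ alone; its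
inverse arises by exchanging g₁ and g₂ and is controlled by those of χ alone. This decouples the two
integrability requirements. In polar coordinates the composite becomes a homeomorphism of the disk,
and integrating Φ of the difference quotients over (x, y) is a linear change of variables away from
the Douglas integral (`memW1_of_boundaryLipschitz`).

From the disk to the boundary. The map and its inverse are treated separately. Two boundary points
at angular distance 2d are joined through a common interior point at depth d, by two curves that are
straight segments in polar coordinates. With depth parametrized as τ²d, the difference quotient is
bounded by means over τ of τ · 4|Df|. Jensen's inequality moves Φ inside, (aInc)ₚ extracts a factor
τ^p, and the substitution y = τ²d costs τ⁻²; since p > 1, the integral of τ^(p-2) over (0, 1] is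
finite. This yields `exists_lintegral_douglasKernel_le` for C¹ maps. Mollification combined with a
slight dilation, followed by Fatou's lemma, extends the estimate to continuous Sobolev maps. -/

section

/-! ### Modulars of N-functions -/

/-- The value of `Φ` at a real number (negative numbers are sent to `Φ 0`), in `[0, ∞]`. -/
def modular (Φ : ℝ≥0 → ℝ≥0) (x : ℝ) : ℝ≥0∞ := Φ x.toNNReal

theorem modular_norm {E : Type*} [SeminormedAddCommGroup E] (Φ : ℝ≥0 → ℝ≥0) (z : E) :
    modular Φ ‖z‖ = Φ ‖z‖₊ := by
  rw [modular, norm_toNNReal]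

theorem modular_lt_top (Φ : ℝ≥0 → ℝ≥0) (x : ℝ) : modular Φ x < ⊤ := ENNReal.coe_lt_top

variable {Φ : ℝ≥0 → ℝ≥0}

theorem IsNFunction.modular_mono (h : IsNFunction Φ) : Monotone (modular Φ) := fun _ _ hxy =>
  ENNReal.coe_le_coe.2 (h.mono (Real.toNNReal_le_toNNReal hxy))

theorem IsNFunction.continuous_modular (h : IsNFunction Φ) : Continuous (modular Φ) :=
  ENNReal.continuous_coe.comp (h.continuous.comp continuous_real_toNNReal)

theorem IsNFunction.measurable_modular (h : IsNFunction Φ) : Measurable (modular Φ) :=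
  h.continuous_modular.measurable

theorem IsNFunction.modular_const_mul_le (h : IsNFunction Φ) (hd : IsDoubling Φ) (K : ℝ) :
    ∃ C : ℝ≥0, ∀ x, 0 ≤ x → modular Φ (K * x) ≤ C * modular Φ x := by
  obtain ⟨D, -, hD⟩ := hd
  have key : ∀ (n : ℕ) (t : ℝ≥0), Φ (2 ^ n * t) ≤ D ^ n * Φ t := by
    intro n
    induction n with
    | zero => intro t; simp
    | succ n ih =>
      intro t
      calc Φ (2 ^ (n + 1) * t) = Φ (2 * (2 ^ n * t)) := by ring_nf
        _ ≤ D * Φ (2 ^ n * t) := hD _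
        _ ≤ D * (D ^ n * Φ t) := by gcongr; exact ih t
        _ = D ^ (n + 1) * Φ t := by ring
  obtain ⟨n, hn⟩ := pow_unbounded_of_one_lt K (one_lt_two)
  refine ⟨D ^ n, fun x hx => ?_⟩
  calc modular Φ (K * x) ≤ modular Φ (2 ^ n * x) := h.modular_mono (by gcongr)
    _ ≤ _ := by
      unfold modular
      rw [Real.toNNReal_mul (by positivity), Real.toNNReal_pow (by norm_num)]
      have := key n x.toNNReal
      rw [Real.toNNReal_ofNat]
      exact_mod_cast this

theorem IsNFunction.modular_add_le (h : IsNFunction Φ) (hd : IsDoubling Φ) :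
    ∃ C : ℝ≥0, ∀ x y, 0 ≤ x → 0 ≤ y →
      modular Φ (x + y) ≤ C * (modular Φ x + modular Φ y) := by
  obtain ⟨C, hC⟩ := h.modular_const_mul_le hd 2
  refine ⟨C, fun x y hx hy => ?_⟩
  rcases le_total x y with hxy | hxy
  · calc modular Φ (x + y) ≤ modular Φ (2 * y) := h.modular_mono (by linarith)
      _ ≤ C * modular Φ y := hC y hy
      _ ≤ _ := by gcongr; exact le_add_self
  · calc modular Φ (x + y) ≤ modular Φ (2 * x) := h.modular_mono (by linarith)
      _ ≤ C * modular Φ x := hC x hx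
      _ ≤ _ := by gcongr; exact le_self_add

/-- Almost-increase gives the factor τ^p only when τx exceeds `t₀`. Otherwise Φ(τx) ≤ Φ(t₀), which
goes into an additive constant; this is harmless because all later integrals are over sets of finite
measure. -/
theorem IsNFunction.modular_mul_le_of_aInc (h : IsNFunction Φ) {p : ℝ} {t₀ : ℝ≥0}
    (hi : IsAInc Φ p t₀) :
    ∃ C : ℝ≥0, ∀ τ x, 0 < τ → τ ≤ 1 → 0 ≤ x →
      modular Φ (τ * x) ≤ C * ENNReal.ofReal (τ ^ p) * modular Φ x + C := by
  obtain ⟨A, -, hA⟩ := hi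
  refine ⟨max A (Φ t₀), fun τ x hτ hτ1 hx => ?_⟩
  by_cases hlt : (τ * x).toNNReal ≤ t₀
  · calc modular Φ (τ * x) ≤ Φ t₀ := ENNReal.coe_le_coe.2 (h.mono hlt)
      _ ≤ (max A (Φ t₀) : ℝ≥0) := ENNReal.coe_le_coe.2 (le_max_right _ _)
      _ ≤ _ := le_add_self
  · push Not at hlt
    have hpos : 0 < τ * x := Real.toNNReal_pos.1 (lt_of_le_of_lt (zero_le) hlt)
    have hx0 : 0 < x := pos_of_mul_pos_right hpos hτ.le
    have := hA (τ * x).toNNReal x.toNNReal hlt.le (Real.toNNReal_pos.2 hpos)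
      (Real.toNNReal_le_toNNReal (by nlinarith))
    have hx' : 0 < x.toNNReal := Real.toNNReal_pos.2 hx0
    have hτ' : 0 < τ.toNNReal := Real.toNNReal_pos.2 hτ
    rw [Real.toNNReal_mul hτ.le, NNReal.mul_rpow] at this
    have h2 : Φ (τ.toNNReal * x.toNNReal) ≤ A * τ.toNNReal ^ p * Φ x.toNNReal := by
      rw [div_le_iff₀ (by positivity)] at this
      refine this.trans (le_of_eq ?_)
      field_simp
    calc modular Φ (τ * x) ≤ ((A * τ.toNNReal ^ p * Φ x.toNNReal : ℝ≥0) : ℝ≥0∞) := by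
          rw [modular, Real.toNNReal_mul hτ.le]; exact ENNReal.coe_le_coe.2 h2
      _ = A * ENNReal.ofReal (τ ^ p) * modular Φ x := by
          rw [modular, ENNReal.ofReal, Real.toNNReal_rpow_of_nonneg hτ.le]; push_cast; rfl
      _ ≤ (max A (Φ t₀) : ℝ≥0) * ENNReal.ofReal (τ ^ p) * modular Φ x := by
          gcongr; exact le_max_left _ _
      _ ≤ _ := le_self_add

/-- Superlinear growth: on a set of finite measure, a finite modular of the differential forces the
differential to be integrable. -/
theorem IsNFunction.ofReal_le_modular (h : IsNFunction Φ) :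
    ∃ C : ℝ≥0, ∀ x, ENNReal.ofReal x ≤ C + modular Φ x := by
  obtain ⟨T, hT⟩ := (h.tendsto_atTop.eventually_ge_atTop 1).exists_forall_of_atTop
  refine ⟨T, fun x => ?_⟩
  rcases le_total x.toNNReal (max T 1) with hx | hx
  · rcases le_total x.toNNReal T with hxT | hxT
    · exact (ENNReal.coe_le_coe.2 hxT).trans le_self_add
    · refine le_trans ?_ le_add_self
      rcases eq_or_ne x.toNNReal 0 with h0 | h0
      · simp [ENNReal.ofReal, h0]
      · have := hT _ hxT
        rw [le_div_iff₀ (pos_iff_ne_zero.2 h0), one_mul] at this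
        exact ENNReal.coe_le_coe.2 this
  · have hx1 : 0 < x.toNNReal := lt_of_lt_of_le (by simp) hx
    have := hT _ ((le_max_left _ _).trans hx)
    rw [le_div_iff₀ hx1, one_mul] at this
    exact (ENNReal.coe_le_coe.2 this).trans le_add_self

theorem IsNFunction.modular_integral_le (h : IsNFunction Φ) {α : Type*} [MeasurableSpace α]
    {μ : Measure α} [IsProbabilityMeasure μ] {f : α → ℝ} (hf : Integrable f μ)
    (hf0 : ∀ᵐ x ∂μ, 0 ≤ f x) :
    modular Φ (∫ x, f x ∂μ) ≤ ∫⁻ x, modular Φ (f x) ∂μ := by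
  -- Real-valued Jensen needs Φ ∘ f integrable; when the right-hand side is infinite there is
  -- nothing to prove.
  by_cases htop : ∫⁻ x, modular Φ (f x) ∂μ = ⊤
  · rw [htop]; exact le_top
  let g : ℝ → ℝ := fun x => Φ x.toNNReal
  have hg : Continuous g := NNReal.continuous_coe.comp (h.continuous.comp continuous_real_toNNReal)
  have hconv : ConvexOn ℝ (Ici 0) g := by
    refine ⟨convex_Ici 0, fun x hx y hy a b ha hb hab => ?_⟩
    have := h.convex.2 (mem_univ x.toNNReal) (mem_univ y.toNNReal) (zero_le (a := a.toNNReal))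
      (zero_le (a := b.toNNReal)) (by rw [← Real.toNNReal_add ha hb, hab, Real.toNNReal_one])
    have h3 := NNReal.coe_le_coe.2 this
    simp only [smul_eq_mul, NNReal.coe_add, NNReal.coe_mul, Real.coe_toNNReal _ ha,
      Real.coe_toNNReal _ hb] at h3 ⊢
    refine le_trans (le_of_eq ?_) h3
    simp only [g]
    rw [Real.toNNReal_add (mul_nonneg ha hx) (mul_nonneg hb hy), Real.toNNReal_mul ha,
      Real.toNNReal_mul hb]
  have hgf : ∀ x, ENNReal.ofReal (g (f x)) = modular Φ (f x) := fun x => by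
    simp [g, modular]
  have hint : Integrable (g ∘ f) μ := by
    refine ⟨hg.comp_aestronglyMeasurable hf.1, ?_⟩
    rw [hasFiniteIntegral_iff_ofReal (f := g ∘ f) (Eventually.of_forall fun x => NNReal.coe_nonneg (Φ _))]
    simp only [Function.comp, hgf]
    exact lt_of_le_of_ne le_top htop
  have := hconv.map_integral_le hg.continuousOn isClosed_Ici hf0 hf hint
  calc modular Φ (∫ x, f x ∂μ) = ENNReal.ofReal (g (∫ x, f x ∂μ)) := by simp [g, modular]
    _ ≤ ENNReal.ofReal (∫ x, g (f x) ∂μ) := ENNReal.ofReal_le_ofReal this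
    _ = ∫⁻ x, ENNReal.ofReal (g (f x)) ∂μ :=
        ofReal_integral_eq_lintegral_ofReal hint (Eventually.of_forall fun x => NNReal.coe_nonneg _)
    _ = _ := by simp only [hgf]

end

/-! ### Lifts of circle homeomorphisms to the line -/

/-- A lift of the circle homeomorphism to an increasing homeomorphism of the line, with inverse `χ`. -/
structure IsLift (φ : Circle ≃ₜ Circle) (ψ χ : ℝ → ℝ) : Prop where
  continuous : Continuous ψ
  continuous_inv : Continuous χ
  strictMono : StrictMono ψ
  strictMono_inv : StrictMono χ
  left_inv : ∀ x, χ (ψ x) = x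
  right_inv : ∀ x, ψ (χ x) = x
  add_two_pi : ∀ x, ψ (x + 2 * Real.pi) = ψ x + 2 * Real.pi
  add_two_pi_inv : ∀ x, χ (x + 2 * Real.pi) = χ x + 2 * Real.pi
  map_exp : ∀ x, φ (Circle.exp x) = Circle.exp (ψ x)
  map_exp_inv : ∀ x, φ.symm (Circle.exp x) = Circle.exp (χ x)

theorem IsLift.symm {φ : Circle ≃ₜ Circle} {ψ χ : ℝ → ℝ} (h : IsLift φ ψ χ) :
    IsLift φ.symm χ ψ :=
  ⟨h.2, h.1, h.4, h.3, h.6, h.5, h.8, h.7, h.10, h.9⟩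

theorem exists_continuous_lift {f : Circle → Circle} (hf : Continuous f) :
    ∃ ψ : ℝ → ℝ, Continuous ψ ∧ ∀ x, f (Circle.exp x) = Circle.exp (ψ x) := by
  obtain ⟨e₀, he₀⟩ := Circle.exp_surjective (f (Circle.exp 0))
  obtain ⟨F, ⟨-, hF⟩, -⟩ := Circle.isCoveringMap_exp.existsUnique_continuousMap_lifts
    (⟨fun x : ℝ => f (Circle.exp x), hf.comp Circle.exp.continuous⟩ : C(ℝ, Circle)) 0 e₀ he₀
  exact ⟨F, F.continuous, fun x => (congrFun hF x).symm⟩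

/-- The two maps differ by 2π times an integer depending continuously on the point, hence constant
on the connected line. -/
theorem exists_int_of_exp_eq_exp {u v : ℝ → ℝ} (hu : Continuous u) (hv : Continuous v)
    (h : ∀ x, Circle.exp (u x) = Circle.exp (v x)) :
    ∃ n : ℤ, ∀ x, u x = v x + n * (2 * Real.pi) := by
  choose m hm using fun x => Circle.exp_eq_exp.1 (h x)
  have hmc : Continuous fun x => ((m x : ℤ) : ℝ) := by
    have : (fun x => ((m x : ℤ) : ℝ)) = fun x => (u x - v x) / (2 * Real.pi) := by
      funext x
      rw [hm x]; field_simp; ring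
    rw [this]; fun_prop
  have hmc' : Continuous m := by
    exact Int.isClosedEmbedding_coe_real.isEmbedding.continuous_iff.2 hmc
  refine ⟨m 0, fun x => ?_⟩
  rw [PreconnectedSpace.constant inferInstance hmc' (x := 0) (y := x)]
  exact hm x

/-- Lifts of `φ` and of its inverse compose to a translation, which is normalized away, so they are
mutually inverse. A continuous injection of the line is strictly monotone or strictly antitone. -/
theorem exists_lift_or_antilift (φ : Circle ≃ₜ Circle) :
    (∃ ψ χ, IsLift φ ψ χ) ∨ ∃ ψ : ℝ → ℝ, StrictAnti ψ ∧ Continuous ψ ∧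
      ∀ x, φ (Circle.exp x) = Circle.exp (ψ x) := by
  obtain ⟨ψ, hψ, hφψ⟩ := exists_continuous_lift φ.continuous
  obtain ⟨χ₀, hχ₀, hφχ₀⟩ := exists_continuous_lift φ.symm.continuous
  obtain ⟨k, hk⟩ := exists_int_of_exp_eq_exp (u := fun x => χ₀ (ψ x)) (v := fun x => x)
    (hχ₀.comp hψ) continuous_id (fun x => by rw [← hφχ₀, ← hφψ, φ.symm_apply_apply])
  set χ : ℝ → ℝ := fun x => χ₀ x - k * (2 * Real.pi) with hχdef
  have hχ : Continuous χ := hχ₀.sub continuous_const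
  have hl : ∀ x, χ (ψ x) = x := fun x => by simp only [hχdef, hk x]; ring
  have hφχ : ∀ x, φ.symm (Circle.exp x) = Circle.exp (χ x) := fun x => by
    rw [hφχ₀, Circle.exp_eq_exp]; exact ⟨k, by simp [hχdef]⟩
  obtain ⟨m, hm⟩ := exists_int_of_exp_eq_exp (u := fun x => ψ (χ x)) (v := fun x => x)
    (hψ.comp hχ) continuous_id (fun x => by rw [← hφψ, ← hφχ, φ.apply_symm_apply])
  have hinj : Function.Injective ψ := fun x y hxy => by rw [← hl x, hxy, hl y]
  have hinjχ : Function.Injective χ := fun x y hxy => by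
    have h1 := hm x
    have h2 := hm y
    rw [hxy] at h1
    linarith
  have hr : ∀ x, ψ (χ x) = x := fun x => hinjχ (hl (χ x))
  rcases hψ.strictMono_of_inj hinj with hmono | hanti
  swap
  · exact Or.inr ⟨ψ, hanti, hψ, hφψ⟩
  left
  have hmonoχ : StrictMono χ := fun x y hxy => by
    rw [← hmono.lt_iff_lt, hr, hr]; exact hxy
  obtain ⟨n, hn⟩ := exists_int_of_exp_eq_exp (u := fun x => ψ (x + 2 * Real.pi)) (v := ψ)
    (by fun_prop) hψ (fun x => by rw [← hφψ, ← hφψ, Circle.exp_add, Circle.exp_two_pi, mul_one])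
  obtain ⟨n', hn'⟩ := exists_int_of_exp_eq_exp (u := fun x => χ (x + 2 * Real.pi)) (v := χ)
    (by fun_prop) hχ (fun x => by rw [← hφχ, ← hφχ, Circle.exp_add, Circle.exp_two_pi, mul_one])
  have hpi := Real.two_pi_pos
  have hn0 : 0 < n := by
    have : ψ 0 < ψ (0 + 2 * Real.pi) := hmono (by linarith)
    have h2 := hn 0
    rw [h2] at this
    have h3 : (0 : ℝ) < n * (2 * Real.pi) := by linarith
    exact_mod_cast pos_of_mul_pos_left h3 hpi.le
  have hn'0 : 0 < n' := by
    have : χ 0 < χ (0 + 2 * Real.pi) := hmonoχ (by linarith)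
    have h2 := hn' 0
    rw [h2] at this
    have h3 : (0 : ℝ) < n' * (2 * Real.pi) := by linarith
    exact_mod_cast pos_of_mul_pos_left h3 hpi.le
  -- Both translation degrees are positive integers, hence at least one. The lower bound for χ, read
  -- through ψ, is an upper bound for ψ, so the degree is exactly one.
  have hge : ∀ x, χ x + 2 * Real.pi ≤ χ (x + 2 * Real.pi) := fun x => by
    have h2 := hn' x
    rw [h2]
    have : (1 : ℝ) ≤ n' := by exact_mod_cast hn'0
    nlinarith
  have hge1 : ∀ x, ψ x + 2 * Real.pi ≤ ψ (x + 2 * Real.pi) := fun x => by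
    have h2 := hn x
    rw [h2]
    have : (1 : ℝ) ≤ n := by exact_mod_cast hn0
    nlinarith
  have hle1 : ∀ x, ψ (x + 2 * Real.pi) ≤ ψ x + 2 * Real.pi := fun x => by
    rw [← hmonoχ.le_iff_le, hl]
    calc x + 2 * Real.pi = χ (ψ x) + 2 * Real.pi := by rw [hl]
      _ ≤ _ := hge _
  have h1 : ∀ x, ψ (x + 2 * Real.pi) = ψ x + 2 * Real.pi := fun x => le_antisymm (hle1 x) (hge1 x)
  refine ⟨ψ, χ, hψ, hχ, hmono, hmonoχ, hl, hr, h1, fun x => ?_, hφψ, hφχ⟩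
  apply hinj
  rw [hr, h1, hr]

/-! ### Beurling–Ahlfors means of expanding maps -/

/-- A continuous map of the line which commutes with the translation by `2π` and expands distances
by a factor at least `1 / 2`. -/
structure IsExpanding (g : ℝ → ℝ) : Prop where
  continuous : Continuous g
  expand : ∀ x y, x ≤ y → (y - x) / 2 ≤ g y - g x
  add_two_pi : ∀ x, g (x + 2 * Real.pi) = g x + 2 * Real.pi

theorem IsExpanding.monotone {g : ℝ → ℝ} (hg : IsExpanding g) : Monotone g := fun x y hxy => by
  have := hg.expand x y hxy
  linarith

theorem IsExpanding.reflect {g : ℝ → ℝ} (hg : IsExpanding g) : IsExpanding fun s => -g (-s) where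
  continuous := (hg.continuous.comp continuous_neg).neg
  expand x y hxy := by
    have := hg.expand (-y) (-x) (by linarith)
    linarith
  add_two_pi x := by
    have := hg.add_two_pi (-(x + 2 * Real.pi))
    rw [show -(x + 2 * Real.pi) + 2 * Real.pi = -x by ring] at this
    linarith

/-- The mean of `g` over `[x, x + y]`, with a linear continuation for `y ≥ 2π`. -/
def rightMean (g : ℝ → ℝ) (x y : ℝ) : ℝ :=
  (∫ t in (0 : ℝ)..1, g (x + t * min y (2 * Real.pi))) + max (y - 2 * Real.pi) 0 / 2

/-- The mean of `g` over `[x - y, x]`, with a linear continuation for `y ≥ 2π`. -/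
def leftMean (g : ℝ → ℝ) (x y : ℝ) : ℝ := -rightMean (fun s => -g (-s)) (-x) y

/-- The Beurling–Ahlfors extension of `g` to the strip, in characteristic coordinates. -/
def beurlingAhlfors (g : ℝ → ℝ) (p : ℝ × ℝ) : ℝ × ℝ := (rightMean g p.1 p.2, leftMean g p.1 p.2)

/-- The strip on which the Beurling–Ahlfors extension is considered. -/
def strip : Set (ℝ × ℝ) := {p | 0 ≤ p.2 ∧ p.2 ≤ 4 * Real.pi}

/-- The strip in characteristic coordinates. -/
def charStrip : Set (ℝ × ℝ) := {p | 0 ≤ p.1 - p.2 ∧ p.1 - p.2 ≤ 4 * Real.pi}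

section Means

variable {g : ℝ → ℝ}

theorem continuous_rightMean (hg : Continuous g) :
    Continuous fun p : ℝ × ℝ => rightMean g p.1 p.2 := by
  unfold rightMean
  refine Continuous.add ?_ (by fun_prop)
  apply intervalIntegral.continuous_parametric_intervalIntegral_of_continuous' (μ := volume)
    (f := fun (p : ℝ × ℝ) (t : ℝ) => g (p.1 + t * min p.2 (2 * Real.pi)))
  unfold Function.uncurry
  fun_prop

theorem continuous_leftMean (hg : Continuous g) :
    Continuous fun p : ℝ × ℝ => leftMean g p.1 p.2 := by
  have := continuous_rightMean (g := fun s => -g (-s)) (by fun_prop)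
  exact (this.comp ((continuous_fst.neg).prodMk continuous_snd)).neg

theorem continuous_beurlingAhlfors (hg : Continuous g) : Continuous (beurlingAhlfors g) :=
  (continuous_rightMean hg).prodMk (continuous_leftMean hg)

/-- Averaging the expansion inequality over t gives rate 1/2 in x and, since t has mean 1/2, rate
1/4 in y. The linear continuation has slope 1/2, so the rate 1/4 persists beyond 2π. -/
theorem IsExpanding.rightMean_add_le (hg : IsExpanding g) {x x' y y' : ℝ} (hx : x ≤ x') (hy : y ≤ y') :
    rightMean g x y + (x' - x) / 2 + (y' - y) / 4 ≤ rightMean g x' y' := by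
  unfold rightMean
  set m := min y (2 * Real.pi) with hm
  set m' := min y' (2 * Real.pi) with hm'
  have hmm : m ≤ m' := min_le_min_right _ hy
  have hgc := hg.continuous
  have h1 : ∫ t in (0 : ℝ)..1, (g (x + t * m) + ((x' - x) / 2 + t * ((m' - m) / 2))) ≤
      ∫ t in (0 : ℝ)..1, g (x' + t * m') := by
    apply intervalIntegral.integral_mono_on zero_le_one
    · exact Continuous.intervalIntegrable (by fun_prop) _ _
    · exact Continuous.intervalIntegrable (by fun_prop) _ _
    · intro t ht
      have := hg.expand (x + t * m) (x' + t * m') (by nlinarith [ht.1])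
      linarith
  rw [intervalIntegral.integral_add (Continuous.intervalIntegrable (by fun_prop) _ _)
    (Continuous.intervalIntegrable (by fun_prop) _ _),
    intervalIntegral.integral_add (Continuous.intervalIntegrable (by fun_prop) _ _)
    (Continuous.intervalIntegrable (by fun_prop) _ _), intervalIntegral.integral_mul_const,
    integral_id, intervalIntegral.integral_const] at h1
  simp only [smul_eq_mul] at h1
  have h2 : (y' - y) / 4 ≤ (m' - m) / 4 +
      (max (y' - 2 * Real.pi) 0 / 2 - max (y - 2 * Real.pi) 0 / 2) := by
    rcases le_total y (2 * Real.pi) with h | h <;> rcases le_total y' (2 * Real.pi) with h' | h' <;>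
      simp only [hm, hm', min_eq_left, min_eq_right, h, h', max_eq_left, max_eq_right, sub_nonneg,
        sub_nonpos] <;> linarith
  linarith

theorem rightMean_zero (g : ℝ → ℝ) (x : ℝ) : rightMean g x 0 = g x := by
  simp [rightMean, Real.pi_pos.le]

theorem leftMean_zero (g : ℝ → ℝ) (x : ℝ) : leftMean g x 0 = g x := by
  rw [leftMean, rightMean_zero]; simp

theorem IsExpanding.rightMean_add_two_pi (hg : IsExpanding g) (x y : ℝ) :
    rightMean g (x + 2 * Real.pi) y = rightMean g x y + 2 * Real.pi := by
  have hgc := hg.continuous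
  have h : ∀ t : ℝ, g (x + 2 * Real.pi + t * min y (2 * Real.pi)) =
      g (x + t * min y (2 * Real.pi)) + 2 * Real.pi := fun t => by
    rw [← hg.add_two_pi]; ring_nf
  simp only [rightMean, h]
  rw [intervalIntegral.integral_add (Continuous.intervalIntegrable (by fun_prop) _ _)
    (Continuous.intervalIntegrable (by fun_prop) _ _), intervalIntegral.integral_const]
  simp only [smul_eq_mul]
  ring

theorem IsExpanding.leftMean_add_two_pi (hg : IsExpanding g) (x y : ℝ) :
    leftMean g (x + 2 * Real.pi) y = leftMean g x y + 2 * Real.pi := by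
  have := hg.reflect.rightMean_add_two_pi (-(x + 2 * Real.pi)) y
  rw [show -(x + 2 * Real.pi) + 2 * Real.pi = -x by ring] at this
  simp only [leftMean]
  linarith

theorem rightMean_of_le {x y : ℝ} (hy : 2 * Real.pi ≤ y) :
    rightMean g x y = rightMean g x (2 * Real.pi) + (y - 2 * Real.pi) / 2 := by
  simp [rightMean, min_eq_right hy, max_eq_left (sub_nonneg.2 hy)]

theorem leftMean_of_le {x y : ℝ} (hy : 2 * Real.pi ≤ y) :
    leftMean g x y = leftMean g x (2 * Real.pi) - (y - 2 * Real.pi) / 2 := by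
  rw [leftMean, rightMean_of_le hy, leftMean]; ring

/-- The mean of the periodic function g - id over a full period does not depend on the starting
point. Thus at height 2π the extension is a translation, which is why the means are frozen there and
continued linearly: near the centre of the disk the final map is a rotation. -/
theorem IsExpanding.rightMean_two_pi (hg : IsExpanding g) (x : ℝ) :
    rightMean g x (2 * Real.pi) = x + rightMean g 0 (2 * Real.pi) := by
  have hgc := hg.continuous
  have hper : Function.Periodic (fun s => g s - s) (2 * Real.pi) := fun s => by
    simp only [hg.add_two_pi]; ring
  have hpi := Real.two_pi_pos
  have key : ∀ z : ℝ, rightMean g z (2 * Real.pi) =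
      (2 * Real.pi)⁻¹ * (∫ s in (0 : ℝ)..2 * Real.pi, (g s - s)) + (z + Real.pi) := by
    intro z
    have h1 : ∀ t : ℝ, g (z + t * (2 * Real.pi)) =
        (fun s => g s - s) (z + (2 * Real.pi) * t) + (z + t * (2 * Real.pi)) := fun t => by
      simp only; ring_nf
    have h2 := hper.intervalIntegral_add_eq z 0
    rw [zero_add] at h2
    rw [rightMean, min_self, sub_self, max_self]
    simp only [h1]
    rw [intervalIntegral.integral_add (Continuous.intervalIntegrable (by fun_prop) _ _)
      (Continuous.intervalIntegrable (by fun_prop) _ _),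
      intervalIntegral.integral_comp_add_mul (fun s => g s - s) hpi.ne',
      intervalIntegral.integral_add (Continuous.intervalIntegrable (by fun_prop) _ _)
      (Continuous.intervalIntegrable (by fun_prop) _ _), intervalIntegral.integral_mul_const,
      integral_id, intervalIntegral.integral_const]
    simp only [mul_zero, add_zero, mul_one, smul_eq_mul]
    rw [h2]
    ring
  rw [key, key]; ring

theorem IsExpanding.leftMean_two_pi (hg : IsExpanding g) (x : ℝ) :
    leftMean g x (2 * Real.pi) = rightMean g x (2 * Real.pi) - 2 * Real.pi := by
  have h1 : leftMean g x (2 * Real.pi) = rightMean g (x - 2 * Real.pi) (2 * Real.pi) := by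
    rw [leftMean, rightMean, rightMean, min_self, sub_self, max_self, zero_div, add_zero, add_zero,
      ← intervalIntegral.integral_neg]
    have := intervalIntegral.integral_comp_sub_left (a := 0) (b := 1)
      (fun t => g (x - 2 * Real.pi + t * (2 * Real.pi))) 1
    rw [sub_self, sub_zero] at this
    rw [← this]
    congr 1
    funext t
    ring_nf
  rw [h1, hg.rightMean_two_pi, hg.rightMean_two_pi x]; ring

/-- On a ball of radius y₀/4 about (x₀, y₀) all averaging intervals lie in [x₀ - 2y₀, x₀ + 2y₀] and
have length at least y₀/2. Moving an endpoint changes the integral by at most the oscillation of g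
times the displacement, and dividing by the length costs a factor 2/y₀. -/
theorem IsExpanding.abs_rightMean_sub_le (hg : IsExpanding g) {x₀ y₀ x x' y y' : ℝ} (hy₀ : 0 < y₀)
    (hy₀' : y₀ ≤ 4 * Real.pi) (hx : |x - x₀| ≤ y₀ / 4) (hx' : |x' - x₀| ≤ y₀ / 4)
    (hy : |y - y₀| ≤ y₀ / 4) (hy' : |y' - y₀| ≤ y₀ / 4) :
    |rightMean g x y - rightMean g x' y'| ≤
      (1 + 4 * ((g (x₀ + 2 * y₀) - g (x₀ - 2 * y₀)) / y₀)) * (|x - x'| + |y - y'|) := by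
  have hgc := hg.continuous
  set b := g (x₀ - 2 * y₀) with hb
  set M := g (x₀ + 2 * y₀) - b with hM
  have hM0 : 0 ≤ M := sub_nonneg.2 (hg.monotone (by linarith))
  have hbd : ∀ s, x₀ - 2 * y₀ ≤ s → s ≤ x₀ + 2 * y₀ → 0 ≤ g s - b ∧ g s - b ≤ M := fun s h1 h2 =>
    ⟨sub_nonneg.2 (hg.monotone h1), sub_le_sub_right (hg.monotone h2) _⟩
  have hint : ∀ u v, x₀ - 2 * y₀ ≤ u → u ≤ x₀ + 2 * y₀ → x₀ - 2 * y₀ ≤ v → v ≤ x₀ + 2 * y₀ →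
      |∫ s in u..v, (g s - b)| ≤ M * |v - u| := by
    intro u v hu1 hu2 hv1 hv2
    rw [← Real.norm_eq_abs]
    refine intervalIntegral.norm_integral_le_of_norm_le_const fun s hs => ?_
    have h3 : s ∈ uIcc u v := uIoc_subset_uIcc hs
    rw [uIcc, mem_Icc] at h3
    have := hbd s ((le_min hu1 hv1).trans h3.1) (h3.2.trans (max_le hu2 hv2))
    rw [Real.norm_eq_abs, abs_of_nonneg this.1]
    exact this.2
  have hii : ∀ u v, IntervalIntegrable (fun s => g s - b) volume u v := fun u v =>
    Continuous.intervalIntegrable (by fun_prop) _ _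
  -- Subtracting b = g(x₀ - 2y₀) makes the integrand lie between 0 and M, so the bounds involve the
  -- oscillation of g rather than its size.
  have hmean : ∀ x y, 0 < y → rightMean g x y = b + (min y (2 * Real.pi))⁻¹ *
      (∫ s in x..x + min y (2 * Real.pi), (g s - b)) + max (y - 2 * Real.pi) 0 / 2 := by
    intro x y hy
    have hm : 0 < min y (2 * Real.pi) := lt_min hy Real.two_pi_pos
    have := intervalIntegral.integral_comp_add_mul (a := 0) (b := 1) (fun s => g s - b) hm.ne' x
    rw [mul_zero, add_zero, mul_one, smul_eq_mul] at this
    rw [rightMean, ← this, intervalIntegral.integral_sub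
      (Continuous.intervalIntegrable (by fun_prop) _ _)
      (Continuous.intervalIntegrable (by fun_prop) _ _), intervalIntegral.integral_const]
    simp only [smul_eq_mul, mul_comm]
    ring
  rw [abs_le] at hx hx' hy hy'
  have hyp : y₀ / 2 ≤ y := by linarith
  have hyp' : y₀ / 2 ≤ y' := by linarith
  rw [hmean x y (by linarith), hmean x' y' (by linarith)]
  set m := min y (2 * Real.pi) with hm
  set m' := min y' (2 * Real.pi) with hm'
  have hm1 : y₀ / 2 ≤ m := le_min hyp (by linarith)
  have hm1' : y₀ / 2 ≤ m' := le_min hyp' (by linarith)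
  have hm2 : m ≤ y := min_le_left _ _
  have hm2' : m' ≤ y' := min_le_left _ _
  have hmm : |m - m'| ≤ |y - y'| := by
    have := abs_min_sub_min_le_max y (2 * Real.pi) y' (2 * Real.pi)
    simpa using this
  have hmax : |max (y - 2 * Real.pi) 0 - max (y' - 2 * Real.pi) 0| ≤ |y - y'| := by
    have := abs_max_sub_max_le_max (y - 2 * Real.pi) 0 (y' - 2 * Real.pi) 0
    simpa using this
  set W := ∫ s in x..x + m, (g s - b) with hW
  set W' := ∫ s in x'..x' + m', (g s - b) with hW'
  have hWb : |W| ≤ M * m := by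
    refine (hint x (x + m) (by linarith) (by linarith) (by linarith) (by linarith)).trans ?_
    rw [add_sub_cancel_left, abs_of_pos (by linarith)]
  have hWW : |W - W'| ≤ M * (2 * |x - x'| + |m - m'|) := by
    have h1 : W - W' = (∫ s in x'+m'..x + m, (g s - b)) - ∫ s in x'..x, (g s - b) := by
      rw [hW, hW', intervalIntegral.integral_interval_sub_interval_comm' (hii _ _) (hii _ _)
        (hii _ _)]
    have h2 := hint (x' + m') (x + m) (by linarith) (by linarith) (by linarith) (by linarith)
    have h3 := hint x' x (by linarith) (by linarith) (by linarith) (by linarith)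
    have h4 : |x + m - (x' + m')| ≤ |x - x'| + |m - m'| := by
      rw [show x + m - (x' + m') = (x - x') + (m - m') by ring]; exact abs_add_le _ _
    rw [h1]
    refine (abs_sub _ _).trans ?_
    nlinarith
  have hm0 : 0 < m := by linarith
  have hm0' : 0 < m' := by linarith
  have hq : |m⁻¹ * W - m'⁻¹ * W'| ≤ 4 * (M / y₀) * (|x - x'| + |y - y'|) := by
    -- Splits the change of a quotient into the change of the integral and that of the length; the
    -- latter is multiplied by a mean, which is at most M.
    have e1 : m⁻¹ * W - m'⁻¹ * W' = m'⁻¹ * ((W - W') + (m' - m) * (m⁻¹ * W)) := by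
      field_simp; ring
    have e2 : |m⁻¹ * W| ≤ M := by
      rw [abs_mul, abs_of_pos (inv_pos.2 hm0)]
      rw [inv_mul_le_iff₀ hm0]; linarith
    have e3 : |(W - W') + (m' - m) * (m⁻¹ * W)| ≤ M * (2 * (|x - x'| + |y - y'|)) := by
      refine (abs_add_le _ _).trans ?_
      rw [abs_mul, abs_sub_comm m' m]
      have := mul_le_mul hmm e2 (abs_nonneg _) (abs_nonneg _)
      have h5 := mul_le_mul_of_nonneg_left hmm hM0
      nlinarith
    have e4 : m'⁻¹ ≤ 2 / y₀ := by
      rw [inv_le_comm₀ hm0' (by positivity), inv_div]; exact hm1'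
    rw [e1, abs_mul, abs_of_pos (inv_pos.2 hm0')]
    calc m'⁻¹ * |(W - W') + (m' - m) * (m⁻¹ * W)|
        ≤ (2 / y₀) * (M * (2 * (|x - x'| + |y - y'|))) :=
          mul_le_mul e4 e3 (abs_nonneg _) (by positivity)
      _ = _ := by ring
  have hfin : b + m⁻¹ * W + max (y - 2 * Real.pi) 0 / 2 -
      (b + m'⁻¹ * W' + max (y' - 2 * Real.pi) 0 / 2) = (m⁻¹ * W - m'⁻¹ * W') +
      (max (y - 2 * Real.pi) 0 - max (y' - 2 * Real.pi) 0) / 2 := by ring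
  rw [hfin]
  refine (abs_add_le _ _).trans ?_
  rw [abs_div, abs_two]
  have := abs_nonneg (x - x')
  have := abs_nonneg (y - y')
  linarith

theorem IsExpanding.abs_leftMean_sub_le (hg : IsExpanding g) {x₀ y₀ x x' y y' : ℝ} (hy₀ : 0 < y₀)
    (hy₀' : y₀ ≤ 4 * Real.pi) (hx : |x - x₀| ≤ y₀ / 4) (hx' : |x' - x₀| ≤ y₀ / 4)
    (hy : |y - y₀| ≤ y₀ / 4) (hy' : |y' - y₀| ≤ y₀ / 4) :
    |leftMean g x y - leftMean g x' y'| ≤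
      (1 + 4 * ((g (x₀ + 2 * y₀) - g (x₀ - 2 * y₀)) / y₀)) * (|x - x'| + |y - y'|) := by
  have hneg : ∀ u v : ℝ, |-u - -v| = |u - v| := fun u v => by
    rw [← abs_neg]; ring_nf
  have := hg.reflect.abs_rightMean_sub_le (x₀ := -x₀) (x := -x) (x' := -x') hy₀ hy₀'
    (by rwa [hneg]) (by rwa [hneg]) hy hy'
  rw [hneg x x', show -(-x₀ + 2 * y₀) = x₀ - 2 * y₀ by ring,
    show -(-x₀ - 2 * y₀) = x₀ + 2 * y₀ by ring,
    show -g (x₀ - 2 * y₀) - -g (x₀ + 2 * y₀) = g (x₀ + 2 * y₀) - g (x₀ - 2 * y₀) by ring] at this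
  rwa [leftMean, leftMean, hneg]

end Means

/-! ### The homeomorphism of the strip -/

section StripMap

variable {g g₁ g₂ : ℝ → ℝ}

theorem IsExpanding.leftMean_add_le (hg : IsExpanding g) {x x' y y' : ℝ} (hx : x ≤ x')
    (hy : y' ≤ y) :
    leftMean g x y + (x' - x) / 2 + (y - y') / 4 ≤ leftMean g x' y' := by
  have := hg.reflect.rightMean_add_le (neg_le_neg hx) hy
  simp only [leftMean]
  linarith

/-- With p to the left of q, the right mean adds up both increments if y increases, and the left
mean does so if y decreases. In either case one coordinate moves by at least Δx/2 + |Δy|/4. -/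
theorem IsExpanding.dist_le_dist_beurlingAhlfors (hg : IsExpanding g) (p q : ℝ × ℝ) :
    dist p q ≤ 4 * dist (beurlingAhlfors g p) (beurlingAhlfors g q) := by
  wlog hx : p.1 ≤ q.1 generalizing p q
  · rw [dist_comm, dist_comm (beurlingAhlfors g p)]
    exact this q p (le_of_not_ge hx)
  rw [Prod.dist_eq, Prod.dist_eq, Real.dist_eq, Real.dist_eq, Real.dist_eq, Real.dist_eq]
  simp only [beurlingAhlfors]
  have h1 := le_max_left |rightMean g p.1 p.2 - rightMean g q.1 q.2|
    |leftMean g p.1 p.2 - leftMean g q.1 q.2|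
  have h2 := le_max_right |rightMean g p.1 p.2 - rightMean g q.1 q.2|
    |leftMean g p.1 p.2 - leftMean g q.1 q.2|
  set D := max |rightMean g p.1 p.2 - rightMean g q.1 q.2|
    |leftMean g p.1 p.2 - leftMean g q.1 q.2|
  rcases le_total p.2 q.2 with hy | hy
  · have h := hg.rightMean_add_le hx hy
    have h3 := neg_abs_le (rightMean g p.1 p.2 - rightMean g q.1 q.2)
    refine max_le ?_ ?_
    · rw [abs_sub_comm, abs_of_nonneg (by linarith)]; linarith
    · rw [abs_sub_comm, abs_of_nonneg (by linarith)]; linarith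
  · have h := hg.leftMean_add_le hx hy
    have h3 := neg_abs_le (leftMean g p.1 p.2 - leftMean g q.1 q.2)
    refine max_le ?_ ?_
    · rw [abs_sub_comm, abs_of_nonneg (by linarith)]; linarith
    · rw [abs_of_nonneg (by linarith)]; linarith

theorem IsExpanding.injective_beurlingAhlfors (hg : IsExpanding g) :
    Function.Injective (beurlingAhlfors g) := fun p q h => by
  have := hg.dist_le_dist_beurlingAhlfors p q
  rw [h, dist_self, mul_zero] at this
  exact dist_le_zero.1 this

theorem IsExpanding.rightMean_sub_leftMean (hg : IsExpanding g) {x y : ℝ} (hy : 2 * Real.pi ≤ y) :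
    rightMean g x y - leftMean g x y = y := by
  rw [rightMean_of_le hy, leftMean_of_le hy, hg.leftMean_two_pi]; ring

theorem IsExpanding.mapsTo_beurlingAhlfors (hg : IsExpanding g) :
    MapsTo (beurlingAhlfors g) strip charStrip := by
  rintro ⟨x, y⟩ ⟨h0, h1⟩
  simp only at h0 h1
  have a1 := hg.rightMean_add_le (le_refl x) h0
  have a2 := hg.leftMean_add_le (le_refl x) h0
  have a3 := hg.rightMean_add_le (le_refl x) h1
  have a4 := hg.leftMean_add_le (le_refl x) h1
  rw [rightMean_zero] at a1
  rw [leftMean_zero] at a2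
  have a5 := hg.rightMean_sub_leftMean (x := x) (y := 4 * Real.pi) (by linarith [Real.pi_pos])
  constructor
  · simp only [beurlingAhlfors]; linarith
  · simp only [beurlingAhlfors]; linarith

/-- For each height y the equation "right mean = u" has a solution X(y), continuous in y. Along this
curve the left mean runs from u at y = 0 to u - 4π at y = 4π, so it takes every value that the
target strip allows. -/
theorem IsExpanding.surjOn_beurlingAhlfors (hg : IsExpanding g) :
    SurjOn (beurlingAhlfors g) strip charStrip := by
  rintro ⟨u, v⟩ ⟨h0, h1⟩
  simp only at h0 h1
  have hcU := continuous_rightMean hg.continuous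
  have hcV := continuous_leftMean hg.continuous
  have hsurj : ∀ y, ∃ x, rightMean g x y = u := by
    intro y
    have hc : Continuous fun x => rightMean g x y :=
      hcU.comp (continuous_id.prodMk continuous_const)
    refine hc.surjective ?_ ?_ u
    · refine tendsto_atTop_mono' atTop (f₁ := fun x => rightMean g 0 y + x / 2) ?_ ?_
      · filter_upwards [eventually_ge_atTop 0] with x hx
        have := hg.rightMean_add_le hx (le_refl y)
        linarith
      · exact tendsto_atTop_add_const_left _ _ (tendsto_id.atTop_div_const two_pos)
    · refine tendsto_atBot_mono' atBot (f₁ := fun x => rightMean g 0 y + x / 2) ?_ ?_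
      · filter_upwards [eventually_le_atBot 0] with x hx
        have := hg.rightMean_add_le hx (le_refl y)
        linarith
      · exact tendsto_atBot_add_const_left _ _ (tendsto_id.atBot_div_const two_pos)
  choose X hX using hsurj
  have hXc : Continuous X := by
    rw [continuous_iff_continuousAt]
    intro y
    -- The right mean grows in x at rate at least 1/2, so X moves by at most twice the defect in the
    -- equation.
    have hb : ∀ y', |X y' - X y| ≤ 2 * |rightMean g (X y) y' - u| := by
      intro y'
      rcases le_total (X y') (X y) with h | h
      · have h2 := hg.rightMean_add_le h (le_refl y')
        rw [hX] at h2
        rw [abs_sub_comm, abs_of_nonneg (by linarith)]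
        linarith [le_abs_self (rightMean g (X y) y' - u)]
      · have h2 := hg.rightMean_add_le h (le_refl y')
        rw [hX] at h2
        rw [abs_of_nonneg (by linarith)]
        linarith [neg_abs_le (rightMean g (X y) y' - u)]
    have hlim : Tendsto (fun y' => 2 * |rightMean g (X y) y' - u|) (𝓝 y) (𝓝 0) := by
      have : Continuous fun y' => 2 * |rightMean g (X y) y' - u| := by
        have := hcU.comp ((continuous_const (y := X y)).prodMk continuous_id)
        exact continuous_const.mul ((this.sub continuous_const).abs)
      have h3 := this.tendsto y
      simpa [hX] using h3
    rw [ContinuousAt, tendsto_iff_dist_tendsto_zero]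
    exact squeeze_zero (fun _ => dist_nonneg) hb hlim
  have hW : Continuous fun y => leftMean g (X y) y := hcV.comp (hXc.prodMk continuous_id)
  have hpi := Real.pi_pos
  have e0 : leftMean g (X 0) 0 = u := by
    have := hX 0
    rw [rightMean_zero] at this
    rw [leftMean_zero, this]
  have e1 : leftMean g (X (4 * Real.pi)) (4 * Real.pi) = u - 4 * Real.pi := by
    have := hg.rightMean_sub_leftMean (x := X (4 * Real.pi)) (y := 4 * Real.pi) (by linarith)
    rw [hX] at this
    linarith
  obtain ⟨y, hy, hyv⟩ := intermediate_value_Icc' (by positivity : (0 : ℝ) ≤ 4 * Real.pi)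
    hW.continuousOn (show v ∈ Icc _ _ by rw [e0, e1]; constructor <;> linarith)
  exact ⟨(X y, y), hy, Prod.ext (hX y) hyv⟩

/-- The self-map of the strip given by two Beurling–Ahlfors extensions. -/
def stripMap (g₁ g₂ : ℝ → ℝ) (p : ℝ × ℝ) : ℝ × ℝ :=
  Function.invFunOn (beurlingAhlfors g₂) strip (beurlingAhlfors g₁ p)

theorem stripMap_spec (h₁ : IsExpanding g₁) (h₂ : IsExpanding g₂) {p : ℝ × ℝ} (hp : p ∈ strip) :
    stripMap g₁ g₂ p ∈ strip ∧
      beurlingAhlfors g₂ (stripMap g₁ g₂ p) = beurlingAhlfors g₁ p := by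
  have := h₂.surjOn_beurlingAhlfors (h₁.mapsTo_beurlingAhlfors hp)
  exact ⟨Function.invFunOn_mem this, Function.invFunOn_eq this⟩

theorem stripMap_eq (h₁ : IsExpanding g₁) (h₂ : IsExpanding g₂) {p q : ℝ × ℝ} (hp : p ∈ strip)
    (h : beurlingAhlfors g₂ q = beurlingAhlfors g₁ p) : stripMap g₁ g₂ p = q :=
  h₂.injective_beurlingAhlfors ((stripMap_spec h₁ h₂ hp).2.trans h.symm)

theorem stripMap_stripMap (h₁ : IsExpanding g₁) (h₂ : IsExpanding g₂) {p : ℝ × ℝ}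
    (hp : p ∈ strip) : stripMap g₂ g₁ (stripMap g₁ g₂ p) = p :=
  stripMap_eq h₂ h₁ (stripMap_spec h₁ h₂ hp).1 (stripMap_spec h₁ h₂ hp).2.symm

theorem dist_stripMap_le (h₁ : IsExpanding g₁) (h₂ : IsExpanding g₂) {p q : ℝ × ℝ}
    (hp : p ∈ strip) (hq : q ∈ strip) :
    dist (stripMap g₁ g₂ p) (stripMap g₁ g₂ q) ≤
      4 * dist (beurlingAhlfors g₁ p) (beurlingAhlfors g₁ q) := by
  rw [← (stripMap_spec h₁ h₂ hp).2, ← (stripMap_spec h₁ h₂ hq).2]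
  exact h₂.dist_le_dist_beurlingAhlfors _ _

theorem continuousOn_stripMap (h₁ : IsExpanding g₁) (h₂ : IsExpanding g₂) :
    ContinuousOn (stripMap g₁ g₂) strip := by
  intro p hp
  rw [ContinuousWithinAt, tendsto_iff_dist_tendsto_zero]
  have : Tendsto (fun q => 4 * dist (beurlingAhlfors g₁ q) (beurlingAhlfors g₁ p)) (𝓝[strip] p)
      (𝓝 0) := by
    have h := ((continuous_beurlingAhlfors h₁.continuous).dist
      (continuous_const (y := beurlingAhlfors g₁ p))).const_mul 4 |>.tendsto p
    rw [dist_self, mul_zero] at h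
    exact h.mono_left nhdsWithin_le_nhds
  refine squeeze_zero' (Eventually.of_forall fun _ => dist_nonneg) ?_ this
  filter_upwards [self_mem_nhdsWithin] with q hq
  exact dist_stripMap_le h₁ h₂ hq hp

theorem stripMap_add_two_pi (h₁ : IsExpanding g₁) (h₂ : IsExpanding g₂) {x y : ℝ}
    (hp : (x, y) ∈ strip) :
    stripMap g₁ g₂ (x + 2 * Real.pi, y) =
      ((stripMap g₁ g₂ (x, y)).1 + 2 * Real.pi, (stripMap g₁ g₂ (x, y)).2) := by
  apply stripMap_eq h₁ h₂ (p := (x + 2 * Real.pi, y)) hp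
  have := (stripMap_spec h₁ h₂ hp).2
  simp only [beurlingAhlfors, Prod.mk.injEq] at this ⊢
  rw [h₁.rightMean_add_two_pi, h₁.leftMean_add_two_pi, h₂.rightMean_add_two_pi,
    h₂.leftMean_add_two_pi, this.1, this.2]
  exact ⟨rfl, rfl⟩

theorem stripMap_zero (h₁ : IsExpanding g₁) (h₂ : IsExpanding g₂) {x w : ℝ}
    (hw : g₂ w = g₁ x) : stripMap g₁ g₂ (x, 0) = (w, 0) := by
  apply stripMap_eq h₁ h₂ (by simp [strip, Real.pi_pos.le])
  simp [beurlingAhlfors, rightMean_zero, leftMean_zero, hw]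

/-- At these heights both extensions are, up to a constant, the same affine map; the composite keeps
the height and shifts x by the difference of the two constants. -/
theorem stripMap_of_le (h₁ : IsExpanding g₁) (h₂ : IsExpanding g₂) :
    ∃ c, ∀ x y, 2 * Real.pi ≤ y → y ≤ 4 * Real.pi → stripMap g₁ g₂ (x, y) = (x + c, y) := by
  refine ⟨rightMean g₁ 0 (2 * Real.pi) - rightMean g₂ 0 (2 * Real.pi), fun x y hy hy' => ?_⟩
  apply stripMap_eq h₁ h₂ ⟨by linarith [Real.pi_pos], hy'⟩
  simp only [beurlingAhlfors, rightMean_of_le hy, leftMean_of_le hy, h₁.leftMean_two_pi,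
    h₂.leftMean_two_pi, h₁.rightMean_two_pi x, h₂.rightMean_two_pi (x + _), Prod.mk.injEq]
  constructor <;> ring

theorem dist_stripMap_le_of_near (h₁ : IsExpanding g₁) (h₂ : IsExpanding g₂) {x₀ y₀ : ℝ}
    (hy₀ : 0 < y₀) (hy₀' : y₀ ≤ 4 * Real.pi) {p q : ℝ × ℝ} (hp : p ∈ strip) (hq : q ∈ strip)
    (hp₀ : dist p (x₀, y₀) ≤ y₀ / 4) (hq₀ : dist q (x₀, y₀) ≤ y₀ / 4) :
    dist (stripMap g₁ g₂ p) (stripMap g₁ g₂ q) ≤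
      8 * (1 + 4 * ((g₁ (x₀ + 2 * y₀) - g₁ (x₀ - 2 * y₀)) / y₀)) * dist p q := by
  refine (dist_stripMap_le h₁ h₂ hp hq).trans ?_
  simp only [Prod.dist_eq, Real.dist_eq, max_le_iff] at hp₀ hq₀
  have r := h₁.abs_rightMean_sub_le hy₀ hy₀' hp₀.1 hq₀.1 hp₀.2 hq₀.2
  have l := h₁.abs_leftMean_sub_le hy₀ hy₀' hp₀.1 hq₀.1 hp₀.2 hq₀.2
  have hd : |p.1 - q.1| + |p.2 - q.2| ≤ 2 * dist p q := by
    rw [Prod.dist_eq, Real.dist_eq, Real.dist_eq, two_mul]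
    exact add_le_add (le_max_left _ _) (le_max_right _ _)
  have hM : 0 ≤ (g₁ (x₀ + 2 * y₀) - g₁ (x₀ - 2 * y₀)) / y₀ :=
    div_nonneg (sub_nonneg.2 (h₁.monotone (by linarith))) hy₀.le
  have hL : dist (beurlingAhlfors g₁ p) (beurlingAhlfors g₁ q) ≤
      (1 + 4 * ((g₁ (x₀ + 2 * y₀) - g₁ (x₀ - 2 * y₀)) / y₀)) * (|p.1 - q.1| + |p.2 - q.2|) := by
    rw [Prod.dist_eq, Real.dist_eq, Real.dist_eq]
    exact max_le r l
  -- The constant 8 is the Lipschitz constant 4 of the inverse extension times 2, from comparing the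
  -- sum of coordinate differences with the sup distance.
  nlinarith [mul_le_mul_of_nonneg_left hd (show
    0 ≤ 1 + 4 * ((g₁ (x₀ + 2 * y₀) - g₁ (x₀ - 2 * y₀)) / y₀) by positivity)]

end StripMap

/-! ### Chords of the circle and polar coordinates on the disk -/

theorem norm_exp_sub_exp (s t : ℝ) :
    ‖(Circle.exp s : ℂ) - Circle.exp t‖ = 2 * |Real.sin ((s - t) / 2)| := by
  have h : (Circle.exp s : ℂ) - Circle.exp t =
      Circle.exp t * (Complex.exp (Complex.I * ((s - t : ℝ) : ℂ)) - 1) := by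
    rw [Circle.coe_exp, Circle.coe_exp, mul_sub, ← Complex.exp_add]
    push_cast
    ring_nf
  rw [h, norm_mul, Circle.norm_coe, one_mul, Complex.norm_exp_I_mul_ofReal_sub_one]
  simp

theorem norm_exp_sub_exp_le (s t : ℝ) : ‖(Circle.exp s : ℂ) - Circle.exp t‖ ≤ |s - t| := by
  rw [norm_exp_sub_exp]
  have : |Real.sin ((s - t) / 2)| ≤ |(s - t) / 2| := Real.abs_sin_le_abs
  rw [abs_div, abs_two] at this
  linarith

/-- Jordan's inequality for the sine, with π ≤ 4 used to reach the round constant 2. -/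
theorem abs_sub_le_norm_exp_sub_exp {s t : ℝ} (h : |s - t| ≤ Real.pi) :
    |s - t| ≤ 2 * ‖(Circle.exp s : ℂ) - Circle.exp t‖ := by
  rw [norm_exp_sub_exp]
  have h1 : |(s - t) / 2| ≤ Real.pi / 2 := by rw [abs_div, abs_two]; linarith
  have h2 := Real.mul_abs_le_abs_sin h1
  have h3 : (1 : ℝ) / 2 ≤ 2 / Real.pi := by
    rw [div_le_div_iff₀ two_pos Real.pi_pos]; linarith [Real.pi_le_four]
  have h4 : |(s - t) / 2| = |s - t| / 2 := by rw [abs_div, abs_two]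
  have h5 := mul_le_mul_of_nonneg_right h3 (abs_nonneg ((s - t) / 2))
  rw [h4] at h2 h5
  linarith

/-- Polar coordinates on the closed disk; the second coordinate is `4π` times the distance to the
circle. -/
def polarMap (p : ℝ × ℝ) : ℂ := ((1 - p.2 / (4 * Real.pi) : ℝ) : ℂ) * Circle.exp p.1

/-- A right inverse of `polarMap`. -/
def polarInv (z : ℂ) : ℝ × ℝ := (z.arg, 4 * Real.pi * (1 - ‖z‖))

theorem continuous_polarMap : Continuous polarMap := by
  unfold polarMap
  fun_prop

theorem norm_polarMap {p : ℝ × ℝ} (hp : p ∈ strip) : ‖polarMap p‖ = 1 - p.2 / (4 * Real.pi) := by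
  rw [polarMap, norm_mul, Circle.norm_coe, mul_one, Complex.norm_real, Real.norm_of_nonneg]
  rw [sub_nonneg, div_le_one (by positivity)]
  exact hp.2

theorem polarMap_mem {p : ℝ × ℝ} (hp : p ∈ strip) : polarMap p ∈ closedDisk := by
  rw [mem_closedBall_zero_iff, norm_polarMap hp]
  have : 0 ≤ p.2 / (4 * Real.pi) := div_nonneg hp.1 (by positivity)
  linarith

theorem polarInv_mem {z : ℂ} (hz : z ∈ closedDisk) : polarInv z ∈ strip := by
  rw [mem_closedBall_zero_iff] at hz
  have := norm_nonneg z
  have := Real.pi_pos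
  constructor <;> simp only [polarInv] <;> nlinarith

theorem polarMap_polarInv (z : ℂ) : polarMap (polarInv z) = z := by
  simp only [polarMap, polarInv]
  rw [mul_div_cancel_left₀ _ (by positivity : 4 * Real.pi ≠ 0), sub_sub_cancel, Circle.coe_exp]
  exact Complex.norm_mul_exp_arg_mul_I z

theorem polarMap_periodic (y : ℝ) : Function.Periodic (fun x => polarMap (x, y)) (2 * Real.pi) :=
  fun x => by simp only [polarMap, Circle.exp_add, Circle.exp_two_pi, mul_one]

theorem polarMap_of_eq {p : ℝ × ℝ} (hp : p.2 = 4 * Real.pi) : polarMap p = 0 := by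
  rw [polarMap, hp, div_self (by positivity)]; simp

theorem polarMap_zero (x : ℝ) : polarMap (x, 0) = Circle.exp x := by
  simp [polarMap]

theorem eq_or_of_polarMap_eq {p q : ℝ × ℝ} (hp : p ∈ strip) (hq : q ∈ strip)
    (h : polarMap p = polarMap q) :
    p.2 = q.2 ∧ (p.2 = 4 * Real.pi ∨ ∃ n : ℤ, p.1 = q.1 + n * (2 * Real.pi)) := by
  have h2 : p.2 = q.2 := by
    have := congrArg norm h
    rw [norm_polarMap hp, norm_polarMap hq, sub_right_inj, div_left_inj' (by positivity)] at this
    exact this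
  refine ⟨h2, or_iff_not_imp_left.2 fun h4 => ?_⟩
  have hne : ((1 - p.2 / (4 * Real.pi) : ℝ) : ℂ) ≠ 0 := by
    rw [Complex.ofReal_ne_zero, sub_ne_zero]
    intro h5
    rw [eq_comm, div_eq_one_iff_eq (by positivity)] at h5
    exact h4 h5
  rw [polarMap, polarMap, ← h2] at h
  exact Circle.exp_eq_exp.1 (Circle.coe_injective (mul_left_cancel₀ hne h))

theorem dist_polarMap_le {p q : ℝ × ℝ} (hp : p ∈ strip) :
    dist (polarMap p) (polarMap q) ≤ 2 * dist p q := by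
  have hpi : 1 ≤ 4 * Real.pi := by linarith [Real.pi_gt_three]
  have e : polarMap p - polarMap q = ((1 - p.2 / (4 * Real.pi) : ℝ) : ℂ) *
      ((Circle.exp p.1 : ℂ) - Circle.exp q.1) +
      (((q.2 - p.2) / (4 * Real.pi) : ℝ) : ℂ) * Circle.exp q.1 := by
    simp only [polarMap]; push_cast; ring
  have h1 := norm_exp_sub_exp_le p.1 q.1
  have hr : |1 - p.2 / (4 * Real.pi)| ≤ 1 := by
    have a1 : 0 ≤ p.2 / (4 * Real.pi) := div_nonneg hp.1 (by positivity)
    have a2 : p.2 / (4 * Real.pi) ≤ 1 := by rw [div_le_one (by positivity)]; exact hp.2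
    rw [abs_of_nonneg (by linarith)]; linarith
  rw [dist_eq_norm, e]
  refine (norm_add_le _ _).trans ?_
  rw [norm_mul, norm_mul, Circle.norm_coe, Complex.norm_real, Complex.norm_real, mul_one,
    Real.norm_eq_abs, Real.norm_eq_abs, abs_div, abs_of_pos (by positivity : 0 < 4 * Real.pi),
    abs_sub_comm, Prod.dist_eq, Real.dist_eq, Real.dist_eq]
  have h3 : |p.2 - q.2| / (4 * Real.pi) ≤ |p.2 - q.2| := div_le_self (abs_nonneg _) hpi
  have h4 := le_max_left |p.1 - q.1| |p.2 - q.2|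
  have h5 := le_max_right |p.1 - q.1| |p.2 - q.2|
  rw [abs_sub_comm]
  have h6 := mul_le_mul hr h1 (norm_nonneg _) zero_le_one
  rw [abs_sub_comm q.2 p.2]
  linarith

/-- The angle is recovered as x₀ + Im log(w/z₀), which avoids the branch cut of the argument and
lands near the prescribed x₀. Since y₀ ≤ 3π, the modulus of z₀ is at least 1/4, so this branch has
derivative at most 4 in norm at z₀, strictly less than 4π. -/
theorem exists_lipschitz_section {x₀ y₀ : ℝ} (h0 : 0 < y₀) (h3 : y₀ ≤ 3 * Real.pi) {ε : ℝ}
    (hε : 0 < ε) :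
    ∃ σ : ℂ → ℝ × ℝ, ∃ t ∈ 𝓝 (polarMap (x₀, y₀)), LipschitzOnWith (4 * NNReal.pi) σ t ∧
      ∀ w ∈ t, σ w ∈ strip ∧ polarMap (σ w) = w ∧ dist (σ w) (x₀, y₀) ≤ ε := by
  have hpi := Real.pi_pos
  have hpi3 := Real.pi_gt_three
  have hstrip : ((x₀, y₀) : ℝ × ℝ) ∈ strip := ⟨h0.le, by simp only; linarith⟩
  set z₀ := polarMap (x₀, y₀) with hz₀
  have hn : ‖z₀‖ = 1 - y₀ / (4 * Real.pi) := norm_polarMap hstrip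
  have hn1 : 1 / 4 ≤ ‖z₀‖ := by
    rw [hn]
    have : y₀ / (4 * Real.pi) ≤ 3 / 4 := by
      rw [div_le_div_iff₀ (by positivity) (by norm_num)]; linarith
    linarith
  have hn2 : ‖z₀‖ < 1 := by
    rw [hn]
    have : 0 < y₀ / (4 * Real.pi) := by positivity
    linarith
  have hz0 : z₀ ≠ 0 := norm_pos_iff.1 (by linarith)
  let σ : ℂ → ℝ × ℝ := fun w => (x₀ + (Complex.log (w / z₀)).im, 4 * Real.pi * (1 - ‖w‖))
  have hlog : HasStrictDerivAt (fun w => Complex.log (w / z₀)) z₀⁻¹ z₀ := by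
    have h1 : HasStrictDerivAt (fun w : ℂ => w / z₀) (1 / z₀) z₀ :=
      (hasStrictDerivAt_id z₀).div_const z₀
    have h2 := h1.clog (by rw [div_self hz0]; exact Complex.one_mem_slitPlane)
    simpa [hz0] using h2
  obtain ⟨t₁, ht₁, hLip⟩ := hlog.hasStrictFDerivAt.exists_lipschitzOnWith_of_nnnorm_lt
    (4 * NNReal.pi) (by
      rw [← NNReal.coe_lt_coe, coe_nnnorm]
      simp only [ContinuousLinearMap.norm_toSpanSingleton, norm_inv, NNReal.coe_mul,
        NNReal.coe_ofNat, NNReal.coe_real_pi]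
      have : ‖z₀‖⁻¹ ≤ 4 := by
        rw [inv_le_comm₀ (by linarith) (by norm_num)]; linarith
      linarith)
  have hσ0 : σ z₀ = (x₀, y₀) := by
    simp only [σ, div_self hz0, Complex.log_one, Complex.zero_im, add_zero, hn]
    congr 1
    field_simp
    ring
  have hσc : ContinuousAt σ z₀ := by
    refine ContinuousAt.prodMk (continuousAt_const.add ?_) (by fun_prop)
    exact Complex.continuous_im.continuousAt.comp hlog.hasDerivAt.continuousAt
  refine ⟨σ, t₁ ∩ (σ ⁻¹' Metric.closedBall (x₀, y₀) ε ∩ ({0}ᶜ ∩ Metric.ball 0 1)), ?_, ?_, ?_⟩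
  · refine inter_mem ht₁ (inter_mem (hσc ?_) (inter_mem ?_ ?_))
    · rw [hσ0]; exact Metric.closedBall_mem_nhds _ hε
    · exact isOpen_compl_singleton.mem_nhds hz0
    · exact Metric.isOpen_ball.mem_nhds (by simpa using hn2)
  · refine LipschitzOnWith.of_dist_le_mul fun w hw w' hw' => ?_
    have hd := hLip.dist_le_mul w hw.1 w' hw'.1
    rw [Prod.dist_eq]
    refine max_le ?_ ?_
    · simp only [σ, dist_add_left]
      refine le_trans ?_ hd
      rw [Real.dist_eq, dist_eq_norm, ← Complex.sub_im]
      exact Complex.abs_im_le_norm _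
    · simp only [σ, dist_eq_norm]
      rw [← mul_sub, Real.norm_eq_abs, abs_mul, abs_of_pos (by positivity), sub_sub_sub_cancel_left]
      simp only [NNReal.coe_mul, NNReal.coe_ofNat, NNReal.coe_real_pi]
      gcongr
      rw [norm_sub_rev]
      exact abs_norm_sub_norm_le _ _
  · rintro w ⟨-, hwε, hw0, hw1⟩
    refine ⟨polarInv_mem (Metric.ball_subset_closedBall hw1), ?_, hwε⟩
    simp only [polarMap, σ]
    rw [mul_div_cancel_left₀ _ (by positivity : 4 * Real.pi ≠ 0), sub_sub_cancel, Circle.exp_add,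
      Circle.coe_mul]
    have e1 : z₀ = (‖z₀‖ : ℂ) * Circle.exp x₀ := by rw [hn]; rfl
    have e2 := Complex.norm_mul_exp_arg_mul_I (w / z₀)
    rw [Complex.log_im, Circle.coe_exp (w / z₀).arg]
    rw [norm_div, eq_div_iff hz0] at e2
    nth_rw 3 [e1] at e2
    push_cast at e2
    have hn0 : (‖z₀‖ : ℂ) ≠ 0 := by simpa using hz0
    field_simp at e2
    refine Eq.trans ?_ e2
    rw [Circle.coe_exp]; ring_nf

/-! ### Passing from the strip to the disk -/

theorem IsLift.periodic_sub {φ : Circle ≃ₜ Circle} {ψ χ : ℝ → ℝ} (h : IsLift φ ψ χ) :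
    Function.Periodic (fun x => ψ x - x) (2 * Real.pi) := fun x => by
  simp only [h.add_two_pi]; ring

/-- Uniform continuity on a compact interval, spread by periodicity. It makes the chord–arc
comparison applicable to images under ψ at small scales. -/
theorem IsLift.exists_abs_sub_le_pi {φ : Circle ≃ₜ Circle} {ψ χ : ℝ → ℝ} (h : IsLift φ ψ χ) :
    ∃ δ > 0, ∀ s t, |s - t| ≤ δ → |ψ s - ψ t| ≤ Real.pi := by
  have huc := (isCompact_Icc (a := -1) (b := 2 * Real.pi + 1)).uniformContinuousOn_of_continuous
    h.continuous.continuousOn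
  obtain ⟨δ, hδ, H⟩ := Metric.uniformContinuousOn_iff.1 huc Real.pi Real.pi_pos
  refine ⟨min (δ / 2) 1, by positivity, fun s t hst => ?_⟩
  obtain ⟨n, hn, -⟩ := existsUnique_add_zsmul_mem_Ico Real.two_pi_pos s 0
  simp only [zsmul_eq_mul, zero_add] at hn
  have hper : ∀ x, ψ (x + n * (2 * Real.pi)) = ψ x + n * (2 * Real.pi) := fun x => by
    have := h.periodic_sub.int_mul n x
    linarith
  have h1 := hst.trans (min_le_left _ _)
  have h2 := abs_le.1 (hst.trans (min_le_right _ _))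
  have := H (s + n * (2 * Real.pi)) ⟨by linarith [hn.1], by linarith [hn.2]⟩
    (t + n * (2 * Real.pi)) ⟨by linarith [hn.1], by linarith [hn.2]⟩
    (by rw [dist_add_right, Real.dist_eq]; linarith)
  rw [hper, hper, dist_add_right, Real.dist_eq] at this
  exact this.le

theorem IsLift.isExpanding {φ : Circle ≃ₜ Circle} {ψ χ : ℝ → ℝ} (h : IsLift φ ψ χ) :
    IsExpanding fun x => (x + ψ x) / 2 where
  continuous := by
    have := h.continuous
    fun_prop
  expand x y hxy := by
    have := h.strictMono.monotone hxy
    linarith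
  add_two_pi x := by
    simp only [h.add_two_pi]; ring

/-- The self-map of the closed disk induced by a self-map of the strip. -/
def diskMap (H : ℝ × ℝ → ℝ × ℝ) (z : ℂ) : ℂ := polarMap (H (polarInv z))

section DiskMap

variable {g₁ g₂ : ℝ → ℝ}

theorem polarMap_stripMap_add_int (h₁ : IsExpanding g₁) (h₂ : IsExpanding g₂) {x y : ℝ}
    (hp : (x, y) ∈ strip) (n : ℤ) :
    polarMap (stripMap g₁ g₂ (x + n * (2 * Real.pi), y)) = polarMap (stripMap g₁ g₂ (x, y)) := by
  have : Function.Periodic (fun x => polarMap (stripMap g₁ g₂ (x, y))) (2 * Real.pi) := fun x => by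
    simp only
    rw [stripMap_add_two_pi h₁ h₂ (x := x) hp]
    exact polarMap_periodic _ _
  exact this.int_mul n x

/-- Independence of the polar representative: two representatives differ by a multiple of 2π in the
angle, with which the strip map commutes, or both lie at height 4π, which the strip map preserves
and which collapses to the centre. -/
theorem diskMap_polarMap (h₁ : IsExpanding g₁) (h₂ : IsExpanding g₂) {p : ℝ × ℝ}
    (hp : p ∈ strip) : diskMap (stripMap g₁ g₂) (polarMap p) = polarMap (stripMap g₁ g₂ p) := by
  have hq : polarInv (polarMap p) ∈ strip := polarInv_mem (polarMap_mem hp)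
  have hpq := polarMap_polarInv (polarMap p)
  unfold diskMap
  set q := polarInv (polarMap p)
  obtain ⟨h2, h4 | ⟨n, hn⟩⟩ := eq_or_of_polarMap_eq hq hp hpq
  · obtain ⟨c, hc⟩ := stripMap_of_le h₁ h₂
    have hpi := Real.pi_pos
    have e1 := hc q.1 q.2 (by linarith) h4.le
    have e2 := hc p.1 p.2 (by linarith) (by linarith)
    rw [Prod.mk.eta] at e1 e2
    rw [polarMap_of_eq (by rw [e1]; exact h4), polarMap_of_eq (by rw [e2]; simp only; linarith)]
  · have := polarMap_stripMap_add_int h₁ h₂ (x := p.1) (y := p.2) hp n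
    rw [← hn, ← h2, Prod.mk.eta, h2, Prod.mk.eta] at this
    exact this

theorem diskMap_mem (h₁ : IsExpanding g₁) (h₂ : IsExpanding g₂) {z : ℂ} (hz : z ∈ closedDisk) :
    diskMap (stripMap g₁ g₂) z ∈ closedDisk :=
  polarMap_mem (stripMap_spec h₁ h₂ (polarInv_mem hz)).1

theorem diskMap_diskMap (h₁ : IsExpanding g₁) (h₂ : IsExpanding g₂) {z : ℂ}
    (hz : z ∈ closedDisk) :
    diskMap (stripMap g₂ g₁) (diskMap (stripMap g₁ g₂) z) = z := by
  have hp := polarInv_mem hz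
  rw [diskMap.eq_1 (stripMap g₁ g₂), diskMap_polarMap h₂ h₁ (stripMap_spec h₁ h₂ hp).1, stripMap_stripMap h₁ h₂ hp,
    polarMap_polarInv]

/-- Polar coordinates map a compact rectangle onto the disk, so they form a quotient map and
continuity can be tested upstairs, where the jump of the argument does not matter. -/
theorem continuousOn_diskMap (h₁ : IsExpanding g₁) (h₂ : IsExpanding g₂) :
    ContinuousOn (diskMap (stripMap g₁ g₂)) closedDisk := by
  rw [continuousOn_iff_continuous_domRestrict]
  let K : Set (ℝ × ℝ) := Icc (-Real.pi) Real.pi ×ˢ Icc 0 (4 * Real.pi)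
  have hKs : ∀ p ∈ K, p ∈ strip := fun p hp => hp.2
  have : CompactSpace K := isCompact_iff_compactSpace.1 (isCompact_Icc.prod isCompact_Icc)
  let f : K → closedDisk := fun p => ⟨polarMap p, polarMap_mem (hKs p p.2)⟩
  have hf : Continuous f := (continuous_polarMap.comp continuous_subtype_val).subtype_mk _
  have hsurj : Function.Surjective f := by
    rintro ⟨z, hz⟩
    refine ⟨⟨polarInv z, ⟨?_, polarInv_mem hz⟩⟩, Subtype.ext (polarMap_polarInv z)⟩
    exact ⟨(Complex.neg_pi_lt_arg z).le, Complex.arg_le_pi z⟩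
  rw [(Topology.IsQuotientMap.of_surjective_continuous hsurj hf).continuous_iff]
  have : closedDisk.domRestrict (diskMap (stripMap g₁ g₂)) ∘ f =
      K.domRestrict fun p => polarMap (stripMap g₁ g₂ p) := by
    funext p
    exact diskMap_polarMap h₁ h₂ (hKs p p.2)
  rw [this, ← continuousOn_iff_continuous_domRestrict]
  exact (continuous_polarMap.comp_continuousOn (continuousOn_stripMap h₁ h₂)).mono hKs

/-- The homeomorphism of the closed disk induced by two expanding maps of the line. -/
def diskHomeomorph (h₁ : IsExpanding g₁) (h₂ : IsExpanding g₂) : closedDisk ≃ₜ closedDisk where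
  toFun z := ⟨diskMap (stripMap g₁ g₂) z, diskMap_mem h₁ h₂ z.2⟩
  invFun z := ⟨diskMap (stripMap g₂ g₁) z, diskMap_mem h₂ h₁ z.2⟩
  left_inv z := Subtype.ext (diskMap_diskMap h₁ h₂ z.2)
  right_inv z := Subtype.ext (diskMap_diskMap h₂ h₁ z.2)
  continuous_toFun :=
    (continuousOn_iff_continuous_domRestrict.1 (continuousOn_diskMap h₁ h₂)).subtype_mk _
  continuous_invFun :=
    (continuousOn_iff_continuous_domRestrict.1 (continuousOn_diskMap h₂ h₁)).subtype_mk _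

theorem toFun_apply (h : closedDisk → closedDisk) {z : ℂ} (hz : z ∈ closedDisk) :
    toFun h z = h ⟨z, hz⟩ :=
  Subtype.val_injective.extend_apply (fun z => (h z : ℂ)) 0 ⟨z, hz⟩

theorem exists_lipschitzOnWith_diskMap (h₁ : IsExpanding g₁) (h₂ : IsExpanding g₂) {x₀ y₀ : ℝ}
    (h0 : 0 < y₀) (h3 : y₀ ≤ 3 * Real.pi) :
    ∃ t ∈ 𝓝 (polarMap (x₀, y₀)), LipschitzOnWith
      (2 * (8 * (1 + 4 * ((g₁ (x₀ + 2 * y₀) - g₁ (x₀ - 2 * y₀)) / y₀))).toNNReal * (4 * NNReal.pi))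
      (diskMap (stripMap g₁ g₂)) t := by
  have hpi := Real.pi_pos
  obtain ⟨σ, t, ht, hLip, hσ⟩ := exists_lipschitz_section (x₀ := x₀) h0 h3 (by positivity : 0 < y₀ / 4)
  refine ⟨t, ht, LipschitzOnWith.of_dist_le_mul fun w hw w' hw' => ?_⟩
  obtain ⟨a1, a2, a3⟩ := hσ w hw
  obtain ⟨b1, b2, b3⟩ := hσ w' hw'
  have e := diskMap_polarMap h₁ h₂ a1
  have e' := diskMap_polarMap h₁ h₂ b1
  rw [a2] at e
  rw [b2] at e'
  rw [e, e']
  refine (dist_polarMap_le (stripMap_spec h₁ h₂ a1).1).trans ?_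
  have s1 := dist_stripMap_le_of_near h₁ h₂ h0 (by linarith) a1 b1 a3 b3
  have s2 := hLip.dist_le_mul w hw w' hw'
  set M := 8 * (1 + 4 * ((g₁ (x₀ + 2 * y₀) - g₁ (x₀ - 2 * y₀)) / y₀)) with hM
  have hM0 : 0 ≤ M := by
    have : 0 ≤ (g₁ (x₀ + 2 * y₀) - g₁ (x₀ - 2 * y₀)) / y₀ :=
      div_nonneg (sub_nonneg.2 (h₁.monotone (by linarith))) h0.le
    positivity
  rw [NNReal.coe_mul, NNReal.coe_mul, Real.coe_toNNReal M hM0, NNReal.coe_ofNat]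
  have := mul_le_mul_of_nonneg_left s2 hM0
  linarith

/-- Modulus below 1/2 means height above 2π, where the strip map is a translation; downstairs it is
a rotation. -/
theorem exists_lipschitzOnWith_diskMap_of_norm_lt (h₁ : IsExpanding g₁) (h₂ : IsExpanding g₂)
    {z : ℂ} (hz : ‖z‖ < 1 / 2) :
    ∃ t ∈ 𝓝 z, LipschitzOnWith 1 (diskMap (stripMap g₁ g₂)) t := by
  obtain ⟨c, hc⟩ := stripMap_of_le h₁ h₂
  have hrot : ∀ w : ℂ, ‖w‖ < 1 / 2 → diskMap (stripMap g₁ g₂) w = w * Circle.exp c := by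
    intro w hw
    have hpi := Real.pi_pos
    have hn := norm_nonneg w
    rw [diskMap, polarInv, hc _ _ (by nlinarith) (by nlinarith)]
    have := polarMap_polarInv w
    simp only [polarMap, polarInv] at this ⊢
    rw [Circle.exp_add, Circle.coe_mul, ← mul_assoc, this]
  refine ⟨Metric.ball 0 (1 / 2), Metric.isOpen_ball.mem_nhds (by simpa using hz),
    LipschitzOnWith.of_dist_le_mul fun w hw w' hw' => ?_⟩
  rw [mem_ball_zero_iff] at hw hw'
  rw [hrot w hw, hrot w' hw', dist_eq_norm, dist_eq_norm, ← sub_mul, norm_mul, Circle.norm_coe]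
  simp

end DiskMap

/-! ### Lipschitz bounds in terms of the boundary map -/

/-- Local Lipschitz bounds for a map of the disk in terms of the oscillation of its boundary map. -/
def BoundaryLipschitz (f : ℂ → ℂ) (φ : Circle → ℂ) : Prop :=
  (∀ z ∈ disk, ∃ K : ℝ≥0, ∃ t ∈ 𝓝 z, LipschitzOnWith K f t) ∧
  ∃ C : ℝ≥0, ∃ δ > 0, ∀ x y : ℝ, 0 < y → y < δ → ∃ t ∈ 𝓝 (polarMap (x, y)), LipschitzOnWith
    (C * (1 + ‖φ (Circle.exp (x + 2 * y)) - φ (Circle.exp (x - 2 * y))‖₊ / y.toNNReal)) f t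

theorem IsLift.boundaryLipschitz {φ : Circle ≃ₜ Circle} {ψ χ : ℝ → ℝ} (h : IsLift φ ψ χ) :
    BoundaryLipschitz (diskMap (stripMap (fun x => (x + ψ x) / 2) fun x => (x + χ x) / 2))
      fun ξ => φ ξ := by
  have h₁ := h.isExpanding
  have h₂ := h.symm.isExpanding
  have hpi := Real.pi_pos
  refine ⟨fun z hz => ?_, ?_⟩
  · rw [mem_ball_zero_iff] at hz
    rcases lt_or_ge ‖z‖ (1 / 2) with hlt | hge
    · exact ⟨1, exists_lipschitzOnWith_diskMap_of_norm_lt h₁ h₂ hlt⟩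
    · have := exists_lipschitzOnWith_diskMap h₁ h₂ (x₀ := (polarInv z).1) (y₀ := (polarInv z).2)
        (by simp only [polarInv]; nlinarith) (by simp only [polarInv]; nlinarith)
      rw [Prod.mk.eta, polarMap_polarInv] at this
      exact ⟨_, this⟩
  · obtain ⟨δ, hδ, H⟩ := h.exists_abs_sub_le_pi
    -- The factors 2 and 4π come from polar coordinates and their section. The identity half of g₁
    -- contributes 2 to the difference quotient, whence 1 + 4 · 2 = 9. The threshold δ/4 keeps the
    -- window of length 4y below δ.
    refine ⟨2 * (8 * 9) * (4 * NNReal.pi), min (δ / 4) Real.pi, by positivity,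
      fun x y hy hyδ => ?_⟩
    have hy1 := hyδ.trans_le (min_le_left _ _)
    have hy2 := hyδ.trans_le (min_le_right _ _)
    obtain ⟨t, ht, hLip⟩ := exists_lipschitzOnWith_diskMap h₁ h₂ (x₀ := x) hy (by linarith)
    refine ⟨t, ht, hLip.weaken ?_⟩
    have hm : ψ (x - 2 * y) ≤ ψ (x + 2 * y) := h.strictMono.monotone (by linarith)
    have a1 := abs_sub_le_norm_exp_sub_exp (H (x + 2 * y) (x - 2 * y) (by
      rw [abs_of_nonneg (by linarith)]; linarith))
    rw [abs_of_nonneg (by linarith), ← h.map_exp, ← h.map_exp] at a1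
    rw [← NNReal.coe_le_coe]
    simp only [NNReal.coe_mul, NNReal.coe_ofNat, NNReal.coe_add, NNReal.coe_one, NNReal.coe_div,
      coe_nnnorm, NNReal.coe_real_pi, Real.coe_toNNReal y hy.le]
    set N := ‖(φ (Circle.exp (x + 2 * y)) : ℂ) - φ (Circle.exp (x - 2 * y))‖
    have e : ((x + 2 * y + ψ (x + 2 * y)) / 2 - (x - 2 * y + ψ (x - 2 * y)) / 2) / y =
        2 + ((ψ (x + 2 * y) - ψ (x - 2 * y)) / 2) / y := by field_simp; ring
    have e2 : ((ψ (x + 2 * y) - ψ (x - 2 * y)) / 2) / y ≤ N / y := by gcongr; linarith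
    have e3 : 0 ≤ ((ψ (x + 2 * y) - ψ (x - 2 * y)) / 2) / y := by
      apply div_nonneg _ hy.le; linarith
    rw [e, Real.coe_toNNReal _ (by positivity)]
    have : 8 * (1 + 4 * (2 + ((ψ (x + 2 * y) - ψ (x - 2 * y)) / 2) / y)) ≤
      8 * 9 * (1 + N / y) := by linarith
    have h5 := mul_le_mul_of_nonneg_left this (by positivity : 0 ≤ 2 * (4 * Real.pi))
    linarith

theorem IsLift.extends {φ : Circle ≃ₜ Circle} {ψ χ : ℝ → ℝ} (h : IsLift φ ψ χ) :
    Extends (diskHomeomorph h.isExpanding h.symm.isExpanding) φ := by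
  intro ξ
  obtain ⟨x, rfl⟩ := Circle.exp_surjective ξ
  apply Subtype.ext
  change diskMap _ (Circle.exp x : ℂ) = (φ (Circle.exp x) : ℂ)
  rw [← polarMap_zero, diskMap_polarMap h.isExpanding h.symm.isExpanding
    -- The boundary image is ψ(x), because g₂(ψ(x)) = (ψ(x) + x)/2 = g₁(x).
    (by simp [strip, Real.pi_pos.le]), stripMap_zero h.isExpanding h.symm.isExpanding (w := ψ x)
    (by rw [h.left_inv, add_comm]), polarMap_zero, h.map_exp]

/-! ### Integration over the circle and the disk; the Douglas kernel -/

/-- The interval `(-π, π]`. -/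
abbrev period : Set ℝ := Ioc (-Real.pi) Real.pi

theorem lintegral_period_add {F : ℝ → ℝ≥0∞} (hF : Function.Periodic F (2 * Real.pi)) (c : ℝ) :
    ∫⁻ s in period, F (s + c) = ∫⁻ s in period, F s := by
  have h1 : ∫⁻ s in period, F (s + c) = ∫⁻ s in Ioc (-Real.pi + c) (-Real.pi + c + 2 * Real.pi), F s := by
    have := (measurePreserving_add_right volume c).setLIntegral_comp_preimage_emb
      (measurableEmbedding_addRight c) F (Ioc (-Real.pi + c) (-Real.pi + c + 2 * Real.pi))
    rw [← this, preimage_add_const_Ioc]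
    ring_nf
  have h2 : period = Ioc (-Real.pi) (-Real.pi + 2 * Real.pi) := by
    rw [period]; ring_nf
  rw [h1, h2]
  have : VAddInvariantMeasure (AddSubgroup.zmultiples (2 * Real.pi)) ℝ volume :=
    ⟨fun c s _ => measure_preimage_add _ _ _⟩
  refine (isAddFundamentalDomain_Ioc Real.two_pi_pos _).setLIntegral_eq
    (isAddFundamentalDomain_Ioc Real.two_pi_pos _) F fun g x => ?_
  obtain ⟨g, n, rfl⟩ := g
  change F (n • (2 * Real.pi) + x) = F x
  rw [add_comm]
  exact hF.zsmul n x

theorem lintegral_Ioo_comp_mul {c : ℝ} (hc : 0 < c) (a : ℝ) (G : ℝ → ℝ≥0∞) :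
    ∫⁻ y in Ioo 0 a, G (c * y) = ENNReal.ofReal c⁻¹ * ∫⁻ t in Ioo 0 (c * a), G t := by
  have hpre : (fun y => c * y) ⁻¹' Ioo 0 (c * a) = Ioo 0 a := by
    ext y
    simp only [mem_preimage, mem_Ioo, mul_pos_iff_of_pos_left hc, mul_lt_mul_iff_right₀ hc]
  have hemb : MeasurableEmbedding fun y : ℝ => c * y :=
    (Homeomorph.mulLeft₀ c hc.ne').measurableEmbedding
  rw [← hpre, ← hemb.lintegral_map G, ← hemb.restrict_map, Real.map_volume_mul_left hc.ne',
    Measure.restrict_smul, lintegral_smul_measure, abs_of_pos (inv_pos.2 hc), smul_eq_mul]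

theorem lintegral_disk {F : ℂ → ℝ≥0∞} (hF : Measurable F) :
    ∫⁻ z in disk, F z = ∫⁻ y in Ioo (0 : ℝ) 1, ∫⁻ s in period,
      ENNReal.ofReal (1 - y) * F (((1 - y : ℝ) : ℂ) * Circle.exp s) := by
  have hpolar : ∀ p : ℝ × ℝ, Complex.polarCoord.symm p = (p.1 : ℂ) * Circle.exp p.2 := fun p => by
    rw [Complex.polarCoord_symm_apply, Circle.coe_exp, Complex.exp_mul_I]
    push_cast; rfl
  have hm : Measurable fun p : ℝ × ℝ => ENNReal.ofReal p.1 *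
      disk.indicator F ((p.1 : ℂ) * Circle.exp p.2) := by
    have h1 : Measurable (disk.indicator F) := hF.indicator Metric.isOpen_ball.measurableSet
    have h2 : Continuous fun p : ℝ × ℝ => (p.1 : ℂ) * Circle.exp p.2 := by fun_prop
    exact (ENNReal.measurable_ofReal.comp measurable_fst).mul (h1.comp h2.measurable)
  rw [← lintegral_indicator Metric.isOpen_ball.measurableSet, ← Complex.lintegral_comp_polarCoord_symm]
  simp only [hpolar, smul_eq_mul]
  rw [polarCoord_target, Measure.volume_eq_prod, ← Measure.prod_restrict,
    lintegral_prod _ hm.aemeasurable]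
  have hshift : ∀ G : ℝ → ℝ≥0∞, ∫⁻ y in Ioo (0 : ℝ) 1, G (1 - y) = ∫⁻ r in Ioo (0 : ℝ) 1, G r := by
    intro G
    have := (Measure.measurePreserving_sub_left (volume : Measure ℝ) 1).setLIntegral_comp_preimage_emb
      (Homeomorph.subLeft (1 : ℝ)).measurableEmbedding G (Ioo 0 1)
    rw [← this]
    congr 2
    ext y
    simp
  rw [hshift fun r => ∫⁻ s in period, ENNReal.ofReal r * F ((r : ℂ) * Circle.exp s)]
  have hsub : Ioo (0 : ℝ) 1 ⊆ Ioi 0 := fun r hr => hr.1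
  rw [← inter_eq_left.2 hsub, ← setLIntegral_indicator measurableSet_Ioo]
  refine setLIntegral_congr_fun measurableSet_Ioi fun r hr0 => ?_
  simp only
  have hnorm : ∀ s : ℝ, ‖(r : ℂ) * Circle.exp s‖ = r := fun s => by
    rw [norm_mul, Circle.norm_coe, Complex.norm_real, Real.norm_eq_abs, abs_of_pos hr0, mul_one]
  by_cases hr1 : r < 1
  · rw [indicator_of_mem (show r ∈ Ioo (0 : ℝ) 1 from ⟨hr0, hr1⟩), ← restrict_Ioo_eq_restrict_Ioc]
    refine lintegral_congr fun s => ?_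
    rw [indicator_of_mem]
    rwa [mem_ball_zero_iff, hnorm]
  · rw [indicator_of_notMem (fun h => hr1 h.2)]
    have : ∀ s : ℝ, disk.indicator F ((r : ℂ) * Circle.exp s) = 0 := fun s => by
      rw [indicator_of_notMem]
      rwa [mem_ball_zero_iff, hnorm]
    simp only [this, mul_zero, lintegral_zero]

/-- The change of variables (s, y) ↦ (s + by, s - by), carried out as a shift in s, free by
periodicity, and a scaling of y by 2b. The condition 2ba ≤ π keeps the offset within one period. -/
theorem lintegral_lintegral_antidiagonal_le {A : ℝ → ℝ → ℝ≥0∞}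
    (hA : Measurable (Function.uncurry A))
    (h1 : ∀ t, Function.Periodic (fun s => A s t) (2 * Real.pi))
    (h2 : ∀ s, Function.Periodic (A s) (2 * Real.pi)) {b a : ℝ} (hb : 0 < b)
    (hab : 2 * b * a ≤ Real.pi) :
    ∫⁻ y in Ioo 0 a, ∫⁻ s in period, A (s + b * y) (s - b * y) ≤
      ENNReal.ofReal (2 * b)⁻¹ * ∫⁻ s in period, ∫⁻ t in period, A s t := by
  have e1 : ∀ y, ∫⁻ s in period, A (s + b * y) (s - b * y) =
      ∫⁻ s in period, A (s + 2 * b * y) s := by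
    intro y
    have := lintegral_period_add (F := fun s => A (s + 2 * b * y) s) (fun s => by
      simp only
      rw [h2, show s + 2 * Real.pi + 2 * b * y = s + 2 * b * y + 2 * Real.pi by ring]
      exact h1 s _) (-(b * y))
    rw [← this]
    refine lintegral_congr fun s => ?_
    congr 1
    ring
  simp only [e1]
  rw [lintegral_lintegral_swap]
  swap
  · exact (hA.comp (by fun_prop : Measurable fun p : ℝ × ℝ =>
      (p.2 + 2 * b * p.1, p.2))).aemeasurable
  rw [lintegral_lintegral_swap hA.aemeasurable, ← lintegral_const_mul']
  swap
  · exact ENNReal.ofReal_ne_top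
  refine lintegral_mono fun s => ?_
  simp only
  rw [lintegral_Ioo_comp_mul (by positivity : 0 < 2 * b) a fun t => A (s + t) s]
  refine mul_le_mul_right ?_ _
  calc ∫⁻ t in Ioo 0 (2 * b * a), A (s + t) s ≤ ∫⁻ t in period, A (s + t) s := by
        refine lintegral_mono_set fun t ht => ?_
        exact ⟨by linarith [ht.1, Real.pi_pos], ht.2.le.trans hab⟩
    _ = ∫⁻ t in period, A t s := by
        simp only [add_comm s]
        exact lintegral_period_add (h1 s) s

/-- The integrand of the Douglas condition. -/
def douglasKernel (Φ : ℝ≥0 → ℝ≥0) (φ : Circle → ℂ) (s t : ℝ) : ℝ≥0∞ :=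
  modular Φ ‖(φ (Circle.exp s) - φ (Circle.exp t)) / ((Circle.exp s : ℂ) - Circle.exp t)‖

theorem douglasCondition_iff {Φ : ℝ≥0 → ℝ≥0} {φ : Circle → ℂ} :
    DouglasCondition Φ φ ↔
      ∫⁻ s in period, ∫⁻ t in period, douglasKernel Φ φ s t < ⊤ := by
  simp only [DouglasCondition, douglasKernel, modular_norm]

theorem measurable_douglasKernel {Φ : ℝ≥0 → ℝ≥0} (hΦ : IsNFunction Φ) {φ : Circle → ℂ}
    (hφ : Continuous φ) : Measurable (Function.uncurry (douglasKernel Φ φ)) := by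
  refine hΦ.measurable_modular.comp (Measurable.norm (Measurable.div ?_ ?_))
  · exact Continuous.measurable (by fun_prop)
  · exact Continuous.measurable (by fun_prop)

theorem douglasKernel_periodic_left (Φ : ℝ≥0 → ℝ≥0) (φ : Circle → ℂ) (t : ℝ) :
    Function.Periodic (fun s => douglasKernel Φ φ s t) (2 * Real.pi) := fun s => by
  simp only [douglasKernel, Circle.exp_add, Circle.exp_two_pi, mul_one]

theorem douglasKernel_periodic_right (Φ : ℝ≥0 → ℝ≥0) (φ : Circle → ℂ) (s : ℝ) :
    Function.Periodic (douglasKernel Φ φ s) (2 * Real.pi) := fun t => by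
  simp only [douglasKernel, Circle.exp_add, Circle.exp_two_pi, mul_one]

theorem douglasKernel_comm (Φ : ℝ≥0 → ℝ≥0) (φ : Circle → ℂ) (s t : ℝ) :
    douglasKernel Φ φ s t = douglasKernel Φ φ t s := by
  rw [douglasKernel, douglasKernel, norm_div, norm_div, norm_sub_rev,
    norm_sub_rev (Circle.exp s : ℂ)]

/-! ### Sobolev regularity of locally Lipschitz maps -/

theorem exists_lipschitzOnWith_closedBall {f : ℂ → ℂ}
    (hf : ∀ z ∈ disk, ∃ K : ℝ≥0, ∃ t ∈ 𝓝 z, LipschitzOnWith K f t) {r : ℝ} (hr : r < 1) :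
    ∃ K, LipschitzOnWith K f (Metric.closedBall 0 r) := by
  refine LocallyLipschitzOn.exists_lipschitzOnWith_of_compact (isCompact_closedBall 0 r) ?_
  intro z hz
  obtain ⟨K, t, ht, hK⟩ := hf z (Metric.closedBall_subset_ball hr hz)
  exact ⟨K, t, mem_nhdsWithin_of_mem_nhds ht, hK⟩

/-- Off V the test function and its derivative vanish, so `u` may be replaced by a globally
Lipschitz extension, for which integration by parts is available. -/
theorem integral_fderiv_mul_of_lipschitzOnWith {U V : Set ℂ} (hV : IsOpen V) (hVU : V ⊆ U)
    {u : ℂ → ℝ} {K : ℝ≥0} (hu : LipschitzOnWith K u V) {η : ℂ → ℝ} (hη : ContDiff ℝ (⊤ : ℕ∞) η)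
    (hc : HasCompactSupport η) (hs : tsupport η ⊆ V) (v : ℂ) :
    ∫ z in U, fderiv ℝ η z v * u z = -∫ z in U, η z * fderiv ℝ u z v := by
  obtain ⟨w, hw, hwu⟩ := hu.extend_real
  have hη1 : ContDiff ℝ 1 η := hη.of_le (by exact_mod_cast le_top)
  obtain ⟨D, hD⟩ := hη1.lipschitzWith_of_hasCompactSupport hc one_ne_zero
  have hout : ∀ z, z ∉ V → η z = 0 ∧ fderiv ℝ η z = 0 := fun z hz =>
    ⟨image_eq_zero_of_notMem_tsupport fun h => hz (hs h),
      image_eq_zero_of_notMem_tsupport fun h => hz (hs (tsupport_fderiv_subset ℝ h))⟩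
  have key := hw.integral_lineDeriv_mul_eq (μ := volume) hD hc v
  rw [setIntegral_eq_integral_of_forall_compl_eq_zero fun z hz => by
      simp [(hout z fun h => hz (hVU h)).2],
    setIntegral_eq_integral_of_forall_compl_eq_zero fun z hz => by
      simp [(hout z fun h => hz (hVU h)).1]]
  have e1 : ∫ z, lineDeriv ℝ w z v * η z = ∫ z, η z * fderiv ℝ u z v := by
    refine integral_congr_ae ?_
    filter_upwards [hw.ae_differentiableAt] with z hz
    by_cases hzV : z ∈ V
    · have : u =ᶠ[𝓝 z] w := by
        filter_upwards [hV.mem_nhds hzV] with x hx using hwu hx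
      rw [hz.lineDeriv_eq_fderiv, this.fderiv_eq, mul_comm]
    · simp [(hout z hzV).1]
  have e2 : ∫ z, lineDeriv ℝ η z (-v) * w z = -∫ z, fderiv ℝ η z v * u z := by
    rw [← integral_neg]
    refine integral_congr_ae (Eventually.of_forall fun z => ?_)
    simp only
    rw [(hη1.differentiable one_ne_zero z).lineDeriv_eq_fderiv, map_neg]
    by_cases hzV : z ∈ V
    · rw [hwu hzV, neg_mul]
    · simp [(hout z hzV).2]
  rw [e1, e2] at key
  linarith

/-- The support of each test function lies in a smaller concentric ball, on which `f` is Lipschitz;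
real and imaginary parts are then treated as scalar functions. -/
theorem hasWeakDifferential_fderiv {f : ℂ → ℂ}
    (hf : ∀ z ∈ disk, ∃ K : ℝ≥0, ∃ t ∈ 𝓝 z, LipschitzOnWith K f t)
    (hfi : IntegrableOn f disk) (hDf : IntegrableOn (fderiv ℝ f) disk) :
    HasWeakDifferential disk f (fderiv ℝ f) := by
  refine ⟨hfi, hDf, fun η hη hc hs v => ?_⟩
  obtain ⟨r, hr, hsr⟩ := exists_lt_subset_ball (isClosed_tsupport η) hs
  obtain ⟨K, hK⟩ := exists_lipschitzOnWith_closedBall hf hr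
  have hK' := hK.mono Metric.ball_subset_closedBall
  have hrd : Metric.ball (0 : ℂ) r ⊆ disk := Metric.ball_subset_ball hr.le
  have hη1 : ContDiff ℝ 1 η := hη.of_le (by exact_mod_cast le_top)
  have hdiff : ∀ᵐ z, z ∈ Metric.ball (0 : ℂ) r → DifferentiableAt ℝ f z := by
    filter_upwards [hK'.ae_differentiableWithinAt_of_mem (μ := volume)] with z hz hzr
    exact (hz hzr).differentiableAt (Metric.isOpen_ball.mem_nhds hzr)
  have hcl : ∀ ℓ : ℂ →L[ℝ] ℝ, ℓ (∫ z in disk, fderiv ℝ η z v • f z) =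
      ℓ (-∫ z in disk, η z • fderiv ℝ f z v) := by
    intro ℓ
    have hcont : Continuous fun z => fderiv ℝ η z v :=
      (hη1.continuous_fderiv one_ne_zero).clm_apply continuous_const
    obtain ⟨B, hB⟩ := hcont.bounded_above_of_compact_support (hc.fderiv_apply ℝ v)
    obtain ⟨B', hB'⟩ := hη.continuous.bounded_above_of_compact_support hc
    have i1 : IntegrableOn (fun z => fderiv ℝ η z v • f z) disk :=
      Integrable.bdd_smul hfi _ hcont.aestronglyMeasurable (Eventually.of_forall hB)
    have i2 : IntegrableOn (fun z => η z • fderiv ℝ f z v) disk :=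
      Integrable.bdd_smul (hDf.apply_continuousLinearMap v) _
        hη.continuous.aestronglyMeasurable (Eventually.of_forall hB')
    rw [map_neg, ← ℓ.integral_comp_comm i1, ← ℓ.integral_comp_comm i2]
    have := integral_fderiv_mul_of_lipschitzOnWith Metric.isOpen_ball hrd
      (u := fun z => ℓ (f z)) (ℓ.lipschitz.comp_lipschitzOnWith hK') hη hc hsr v
    simp only [map_smul, smul_eq_mul]
    rw [this]
    congr 1
    refine integral_congr_ae (ae_restrict_of_ae ?_)
    filter_upwards [hdiff] with z hz
    by_cases hzr : z ∈ Metric.ball (0 : ℂ) r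
    · rw [fderiv_fun_comp z ℓ.differentiableAt (hz hzr), ℓ.fderiv]
      rfl
    · simp [image_eq_zero_of_notMem_tsupport fun h => hzr (hsr h)]
  exact Complex.ext (hcl Complex.reCLM) (hcl Complex.imCLM)

/-- In a collar of the circle |Df| is bounded by a difference quotient of `φ` at points symmetric
about the base angle, whose modular integrates to the Douglas integral. Away from the collar `f` is
Lipschitz by compactness. -/
theorem memW1_of_boundaryLipschitz {Φ : ℝ≥0 → ℝ≥0} (hΦ : IsNFunction Φ) (hd : IsDoubling Φ)
    {f : ℂ → ℂ} {φ : Circle → ℂ} (hφ : Continuous φ) (hf : BoundaryLipschitz f φ)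
    (hfb : ∀ z ∈ disk, ‖f z‖ ≤ 1) (hD : DouglasCondition Φ φ) : MemW1 Φ disk f := by
  obtain ⟨hloc, C, δ, hδ, hC⟩ := hf
  have hpi := Real.pi_pos
  have hvol : volume disk < ⊤ := measure_ball_lt_top
  have hmeas : Measurable fun z => modular Φ ‖fderiv ℝ f z‖ :=
    hΦ.measurable_modular.comp (measurable_fderiv ℝ f).norm
  have hfin : ∫⁻ z in disk, modular Φ ‖fderiv ℝ f z‖ < ⊤ := by
    -- With depth y the strip height is 4πy, which must stay below δ. The evaluation points are s ±
    -- 8πy, so the offset 16πy must stay below π.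
    set a := min (δ / (4 * Real.pi)) (1 / 16) with ha
    have ha0 : 0 < a := by positivity
    have ha1 : a ≤ δ / (4 * Real.pi) := min_le_left _ _
    have ha2 : a ≤ 1 / 16 := min_le_right _ _
    obtain ⟨K, hK⟩ := exists_lipschitzOnWith_closedBall hloc (by linarith : 1 - a / 2 < 1)
    obtain ⟨C₁, h₁⟩ := hΦ.modular_const_mul_le hd C
    obtain ⟨C₂, h₂⟩ := hΦ.modular_add_le hd
    obtain ⟨C₃, h₃⟩ := hΦ.modular_const_mul_le hd 4
    have hnear : ∀ y ∈ Ioo 0 a, ∀ s : ℝ, ENNReal.ofReal (1 - y) *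
        modular Φ ‖fderiv ℝ f (((1 - y : ℝ) : ℂ) * Circle.exp s)‖ ≤
        C₁ * (C₂ * (modular Φ 1 + C₃ * douglasKernel Φ φ (s + 8 * Real.pi * y)
          (s - 8 * Real.pi * y))) := by
      rintro y ⟨hy0, hya⟩ s
      have hy1 : y < δ / (4 * Real.pi) := hya.trans_le ha1
      rw [lt_div_iff₀ (by positivity)] at hy1
      obtain ⟨t, ht, hLip⟩ := hC s (4 * Real.pi * y) (by positivity) (by linarith)
      have hz : polarMap (s, 4 * Real.pi * y) = ((1 - y : ℝ) : ℂ) * Circle.exp s := by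
        rw [polarMap, mul_div_cancel_left₀ _ (by positivity : 4 * Real.pi ≠ 0)]
      rw [hz] at ht
      have hb := norm_fderiv_le_of_lipschitzOn ℝ ht hLip
      rw [show s + 2 * (4 * Real.pi * y) = s + 8 * Real.pi * y by ring,
        show s - 2 * (4 * Real.pi * y) = s - 8 * Real.pi * y by ring] at hb
      simp only [NNReal.coe_mul, NNReal.coe_add, NNReal.coe_one, NNReal.coe_div, coe_nnnorm,
        Real.coe_toNNReal (4 * Real.pi * y) (by positivity)] at hb
      set N := ‖φ (Circle.exp (s + 8 * Real.pi * y)) - φ (Circle.exp (s - 8 * Real.pi * y))‖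
        with hN
      have hch1 := norm_exp_sub_exp_le (s + 8 * Real.pi * y) (s - 8 * Real.pi * y)
      have hch2 := abs_sub_le_norm_exp_sub_exp (s := s + 8 * Real.pi * y)
        (t := s - 8 * Real.pi * y) (by rw [abs_of_pos] <;> nlinarith)
      rw [abs_of_pos (by nlinarith)] at hch1 hch2
      -- The chord is at most 16πy, four times the denominator 4πy on the left.
      have hker : N / (4 * Real.pi * y) ≤
          4 * ‖(φ (Circle.exp (s + 8 * Real.pi * y)) - φ (Circle.exp (s - 8 * Real.pi * y))) /
            ((Circle.exp (s + 8 * Real.pi * y) : ℂ) - Circle.exp (s - 8 * Real.pi * y))‖ := by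
        rw [norm_div, ← hN, ← mul_div_assoc]
        set c := ‖(Circle.exp (s + 8 * Real.pi * y) : ℂ) - Circle.exp (s - 8 * Real.pi * y)‖
        have hc0 : 0 < c := by nlinarith
        rw [div_le_div_iff₀ (by positivity) hc0]
        have hN0 : 0 ≤ N := norm_nonneg _
        nlinarith
      have hN1 : 0 ≤ N / (4 * Real.pi * y) := by positivity
      calc ENNReal.ofReal (1 - y) * modular Φ ‖fderiv ℝ f (((1 - y : ℝ) : ℂ) * Circle.exp s)‖
          ≤ 1 * modular Φ (C * (1 + N / (4 * Real.pi * y))) := by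
            gcongr
            · rw [ENNReal.ofReal_le_one]; linarith
            · exact hΦ.modular_mono hb
        _ ≤ C₁ * modular Φ (1 + N / (4 * Real.pi * y)) := by
            rw [one_mul]; exact h₁ _ (by positivity)
        _ ≤ C₁ * (C₂ * (modular Φ 1 + modular Φ (N / (4 * Real.pi * y)))) := by
            gcongr; exact h₂ _ _ zero_le_one hN1
        _ ≤ _ := by
            gcongr
            exact (hΦ.modular_mono hker).trans (h₃ _ (norm_nonneg _))
    have hfar : ∀ y ∈ Ico a 1, ∀ s : ℝ, ENNReal.ofReal (1 - y) *
        modular Φ ‖fderiv ℝ f (((1 - y : ℝ) : ℂ) * Circle.exp s)‖ ≤ modular Φ K := by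
      rintro y ⟨hya, hy1⟩ s
      have hmem : Metric.closedBall (0 : ℂ) (1 - a / 2) ∈ 𝓝 (((1 - y : ℝ) : ℂ) * Circle.exp s) := by
        refine mem_of_superset (Metric.isOpen_ball.mem_nhds ?_) Metric.ball_subset_closedBall
        rw [mem_ball_zero_iff, norm_mul, Circle.norm_coe, mul_one, Complex.norm_real,
          Real.norm_of_nonneg (by linarith)]
        linarith
      calc _ ≤ 1 * modular Φ K := by
            gcongr
            · rw [ENNReal.ofReal_le_one]; linarith
            · exact hΦ.modular_mono (norm_fderiv_le_of_lipschitzOn ℝ hmem hK)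
        _ = _ := one_mul _
    have hA := measurable_douglasKernel hΦ hφ
    rw [lintegral_disk hmeas, ← Ioo_union_Ico_eq_Ioo ha0 (by linarith : a ≤ 1)]
    refine (lintegral_union_le _ _ _).trans_lt (ENNReal.add_lt_top.2 ⟨?_, ?_⟩)
    · calc _ ≤ ∫⁻ y in Ioo 0 a, ∫⁻ s in period, C₁ * (C₂ * (modular Φ 1 + C₃ *
            douglasKernel Φ φ (s + 8 * Real.pi * y) (s - 8 * Real.pi * y))) :=
            setLIntegral_mono' measurableSet_Ioo fun y hy => lintegral_mono fun s => hnear y hy s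
        _ = C₁ * (C₂ * (modular Φ 1 * volume period * volume (Ioo 0 a) + C₃ *
            ∫⁻ y in Ioo 0 a, ∫⁻ s in period,
              douglasKernel Φ φ (s + 8 * Real.pi * y) (s - 8 * Real.pi * y))) := by
            simp only [lintegral_const_mul' _ _ ENNReal.coe_ne_top]
            simp only [lintegral_add_left measurable_const,
              lintegral_const_mul' _ _ ENNReal.coe_ne_top, lintegral_const,
              Measure.restrict_apply_univ]
        _ < ⊤ := by
            have h4 := lintegral_lintegral_antidiagonal_le hA
              (fun t => douglasKernel_periodic_left Φ φ t)
              (fun s => douglasKernel_periodic_right Φ φ s) (b := 8 * Real.pi) (a := a)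
              (by positivity) (by nlinarith)
            have h5 := h4.trans_lt (ENNReal.mul_lt_top ENNReal.ofReal_lt_top
              (douglasCondition_iff.1 hD))
            have h6 : volume period < ⊤ := measure_Ioc_lt_top
            have h7 : volume (Ioo 0 a) < ⊤ := measure_Ioo_lt_top
            have h8 := modular_lt_top Φ 1
            finiteness
    · calc _ ≤ ∫⁻ y in Ico a 1, ∫⁻ s in period, modular Φ K :=
            setLIntegral_mono' measurableSet_Ico fun y hy => lintegral_mono fun s => hfar y hy s
        _ < ⊤ := by
            simp only [lintegral_const, Measure.restrict_apply_univ]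
            have h6 : volume period < ⊤ := measure_Ioc_lt_top
            have h7 : volume (Ico a 1) < ⊤ := measure_Ico_lt_top
            have h8 := modular_lt_top Φ K
            finiteness
  have hDf : IntegrableOn (fderiv ℝ f) disk := by
    refine ⟨(measurable_fderiv ℝ f).aestronglyMeasurable, ?_⟩
    obtain ⟨B, hB⟩ := hΦ.ofReal_le_modular
    rw [hasFiniteIntegral_iff_norm]
    calc _ ≤ ∫⁻ z in disk, (B + modular Φ ‖fderiv ℝ f z‖) := lintegral_mono fun z => hB _
      _ = B * volume disk + ∫⁻ z in disk, modular Φ ‖fderiv ℝ f z‖ := by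
          rw [lintegral_add_left measurable_const, lintegral_const, Measure.restrict_apply_univ]
      _ < ⊤ := by finiteness
  have hfc : ContinuousOn f disk := fun z hz => by
    obtain ⟨K, t, ht, hK⟩ := hloc z hz
    exact (hK.continuousOn.continuousAt ht).continuousWithinAt
  have hfi : IntegrableOn f disk :=
    IntegrableOn.of_bound hvol
      (hfc.aestronglyMeasurable Metric.isOpen_ball.measurableSet) 1
      (ae_restrict_of_forall_mem Metric.isOpen_ball.measurableSet hfb)
  refine ⟨fderiv ℝ f, hasWeakDifferential_fderiv hloc hfi hDf, ?_⟩
  simpa only [modular_norm] using hfin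

/-! ### Extension of an arbitrary circle homeomorphism -/

theorem polarMap_mem_disk {x y : ℝ} (h0 : 0 < y) (h1 : y ≤ 4 * Real.pi) :
    polarMap (x, y) ∈ disk := by
  rw [mem_ball_zero_iff, norm_polarMap ⟨h0.le, h1⟩]
  have : 0 < y / (4 * Real.pi) := div_pos h0 (by positivity)
  simp only
  linarith

theorem BoundaryLipschitz.congr {f g : ℂ → ℂ} {φ : Circle → ℂ} (hf : BoundaryLipschitz f φ)
    (h : EqOn f g disk) : BoundaryLipschitz g φ := by
  have key : ∀ z ∈ disk, ∀ K : ℝ≥0, (∃ t ∈ 𝓝 z, LipschitzOnWith K f t) →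
      ∃ t ∈ 𝓝 z, LipschitzOnWith K g t := by
    rintro z hz K ⟨t, ht, hK⟩
    refine ⟨t ∩ disk, inter_mem ht (Metric.isOpen_ball.mem_nhds hz), fun a ha b hb => ?_⟩
    rw [← h ha.2, ← h hb.2]
    exact hK ha.1 hb.1
  obtain ⟨h1, C, δ, hδ, h2⟩ := hf
  refine ⟨fun z hz => (h1 z hz).imp fun K hK => key z hz K hK, C, min δ (4 * Real.pi),
    lt_min hδ (by positivity), fun x y hy hyδ => ?_⟩
  exact key _ (polarMap_mem_disk hy (hyδ.trans_le (min_le_right _ _)).le) _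
    (h2 x y hy (hyδ.trans_le (min_le_left _ _)))

theorem lipschitzWith_conj : LipschitzWith 1 (starRingEnd ℂ) :=
  Complex.isometry_conj.lipschitz

theorem BoundaryLipschitz.conj_comp {f : ℂ → ℂ} {φ : Circle → ℂ} (hf : BoundaryLipschitz f φ) :
    BoundaryLipschitz (fun z => starRingEnd ℂ (f z)) fun ξ => starRingEnd ℂ (φ ξ) := by
  have key : ∀ z : ℂ, ∀ K : ℝ≥0, (∃ t ∈ 𝓝 z, LipschitzOnWith K f t) →
      ∃ t ∈ 𝓝 z, LipschitzOnWith K (fun z => starRingEnd ℂ (f z)) t := by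
    rintro z K ⟨t, ht, hK⟩
    have := lipschitzWith_conj.comp_lipschitzOnWith hK
    rw [one_mul] at this
    exact ⟨t, ht, this⟩
  obtain ⟨h1, C, δ, hδ, h2⟩ := hf
  refine ⟨fun z hz => (h1 z hz).imp fun K hK => key z K hK, C, δ, hδ, fun x y hy hyδ => ?_⟩
  have := key _ _ (h2 x y hy hyδ)
  rwa [← nnnorm_star (φ _ - φ _), star_sub] at this

theorem conj_polarMap (x y : ℝ) : starRingEnd ℂ (polarMap (x, y)) = polarMap (-x, y) := by
  simp only [polarMap, map_mul, Complex.conj_ofReal, Circle.exp_neg, Circle.coe_inv_eq_conj]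

theorem BoundaryLipschitz.comp_conj {f : ℂ → ℂ} {φ : Circle → ℂ} (hf : BoundaryLipschitz f φ) :
    BoundaryLipschitz (fun z => f (starRingEnd ℂ z)) fun ξ => φ ξ⁻¹ := by
  have key : ∀ z : ℂ, ∀ K : ℝ≥0, (∃ t ∈ 𝓝 (starRingEnd ℂ z), LipschitzOnWith K f t) →
      ∃ t ∈ 𝓝 z, LipschitzOnWith K (fun z => f (starRingEnd ℂ z)) t := by
    rintro z K ⟨t, ht, hK⟩
    have := hK.comp (lipschitzWith_conj.lipschitzOnWith (s := starRingEnd ℂ ⁻¹' t))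
      (mapsTo_preimage _ _)
    rw [mul_one] at this
    exact ⟨_, Complex.continuous_conj.continuousAt ht, this⟩
  obtain ⟨h1, C, δ, hδ, h2⟩ := hf
  refine ⟨fun z hz => (h1 (starRingEnd ℂ z) (by simpa using hz)).imp fun K hK => key z K hK,
    C, δ, hδ, fun x y hy hyδ => key _ _ ?_⟩
  have := h2 (-x) y hy hyδ
  rw [conj_polarMap]
  simp only
  rw [← nnnorm_neg (φ _ - φ _), neg_sub, ← Circle.exp_neg, ← Circle.exp_neg,
    show -(x - 2 * y) = -x + 2 * y by ring, show -(x + 2 * y) = -x - 2 * y by ring]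
  exact this

/-- Complex conjugation of the closed disk. -/
def conjDisk : closedDisk ≃ₜ closedDisk where
  toFun z := ⟨starRingEnd ℂ z, by simpa only [mem_closedBall_zero_iff, RCLike.norm_conj] using z.2⟩
  invFun z := ⟨starRingEnd ℂ z, by simpa only [mem_closedBall_zero_iff, RCLike.norm_conj] using z.2⟩
  left_inv z := by simp
  right_inv z := by simp
  continuous_toFun := by fun_prop
  continuous_invFun := by fun_prop

theorem IsLift.exists_extension {φ : Circle ≃ₜ Circle} {ψ χ : ℝ → ℝ} (h : IsLift φ ψ χ) :
    ∃ H : closedDisk ≃ₜ closedDisk, Extends H φ ∧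
      BoundaryLipschitz (toFun H) (fun ξ => φ ξ) ∧
      BoundaryLipschitz (toFun H.symm) (fun ξ => φ.symm ξ) := by
  refine ⟨_, h.extends, h.boundaryLipschitz.congr fun z hz => ?_,
    h.symm.boundaryLipschitz.congr fun z hz => ?_⟩
  · rw [toFun_apply _ (Metric.ball_subset_closedBall hz)]; rfl
  · rw [toFun_apply _ (Metric.ball_subset_closedBall hz)]; rfl

/-- If `φ` reverses orientation, its composition with ξ ↦ ξ⁻¹, which is complex conjugation, has an
increasing lift. Its extension is followed by conjugation of the disk, an isometry. -/
theorem exists_boundaryLipschitz_extension (φ : Circle ≃ₜ Circle) :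
    ∃ H : closedDisk ≃ₜ closedDisk, Extends H φ ∧
      BoundaryLipschitz (toFun H) (fun ξ => φ ξ) ∧
      BoundaryLipschitz (toFun H.symm) (fun ξ => φ.symm ξ) := by
  rcases exists_lift_or_antilift φ with ⟨ψ, χ, h⟩ | ⟨ψ, hanti, hψ, hφψ⟩
  · exact h.exists_extension
  have hlift : ∃ ψ' χ', IsLift (φ.trans (Homeomorph.inv Circle)) ψ' χ' := by
    rcases exists_lift_or_antilift (φ.trans (Homeomorph.inv Circle)) with h | ⟨ψ', hanti', hψ', h'⟩
    · exact h
    -- The lifts are negatives of each other up to a constant, so they cannot both be decreasing.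
    · exfalso
      obtain ⟨n, hn⟩ := exists_int_of_exp_eq_exp (u := ψ') (v := fun x => -ψ x) hψ' hψ.neg
        (fun x => by rw [← h', Circle.exp_neg, ← hφψ]; rfl)
      have a1 := hanti zero_lt_one
      have a2 := hanti' zero_lt_one
      rw [hn, hn] at a2
      linarith
  obtain ⟨ψ', χ', h⟩ := hlift
  obtain ⟨H, hext, hB, hB'⟩ := h.exists_extension
  refine ⟨H.trans conjDisk, fun ξ => ?_, ?_, ?_⟩
  · apply Subtype.ext
    change starRingEnd ℂ (H (circleToDisk ξ) : ℂ) = φ ξ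
    rw [hext ξ]
    change starRingEnd ℂ (((φ ξ)⁻¹ : Circle) : ℂ) = φ ξ
    rw [Circle.coe_inv_eq_conj, Complex.conj_conj]
  · have := hB.conj_comp.congr (g := toFun (H.trans conjDisk)) fun z hz => by
      simp only
      rw [toFun_apply _ (Metric.ball_subset_closedBall hz),
        toFun_apply _ (Metric.ball_subset_closedBall hz)]
      rfl
    convert this using 2 with ξ
    change (φ ξ : ℂ) = starRingEnd ℂ (((φ ξ)⁻¹ : Circle) : ℂ)
    rw [Circle.coe_inv_eq_conj, Complex.conj_conj]
  · have := hB'.comp_conj.congr (g := toFun (H.trans conjDisk).symm) fun z hz => by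
      have hz' := Metric.ball_subset_closedBall hz
      have hzc : starRingEnd ℂ z ∈ closedDisk := by
        simpa only [mem_closedBall_zero_iff, RCLike.norm_conj] using hz'
      simp only
      rw [toFun_apply _ hz', toFun_apply _ hzc]
      rfl
    convert this using 2 with ξ
    change (φ.symm ξ : ℂ) = φ.symm (ξ⁻¹⁻¹)
    rw [inv_inv]

theorem norm_toFun_le (H : closedDisk → closedDisk) {z : ℂ} (hz : z ∈ closedDisk) :
    ‖toFun H z‖ ≤ 1 := by
  rw [toFun_apply _ hz]
  exact mem_closedBall_zero_iff.1 (H _).2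

theorem exists_extension_of_douglas (φ : Circle ≃ₜ Circle) {Φ Ψ : ℝ≥0 → ℝ≥0}
    (hΦ : IsNFunction Φ) (hΦd : IsDoubling Φ) (hΨ : IsNFunction Ψ) (hΨd : IsDoubling Ψ)
    (h₁ : DouglasCondition Φ fun ξ => φ ξ) (h₂ : DouglasCondition Ψ fun ξ => φ.symm ξ) :
    ∃ h : closedDisk ≃ₜ closedDisk, Extends h φ ∧ MemW1 Φ disk (toFun h) ∧
      MemW1 Ψ disk (toFun h.symm) := by
  obtain ⟨H, hext, hB, hB'⟩ := exists_boundaryLipschitz_extension φ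
  refine ⟨H, hext, ?_, ?_⟩
  · exact memW1_of_boundaryLipschitz hΦ hΦd (by fun_prop) hB
      (fun z hz => norm_toFun_le _ (Metric.ball_subset_closedBall hz)) h₁
  · exact memW1_of_boundaryLipschitz hΨ hΨd (by fun_prop) hB'
      (fun z hz => norm_toFun_le _ (Metric.ball_subset_closedBall hz)) h₂

/-! ### The trace estimate for smooth maps -/

/-- In terms of the offset t between the two angles the integral over s is even in t by symmetry and
periodicity, so only 0 < t < π matters. -/
theorem lintegral_lintegral_le_of_symmetric {A : ℝ → ℝ → ℝ≥0∞}
    (hA : Measurable (Function.uncurry A)) (hcomm : ∀ s t, A s t = A t s)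
    (h2 : ∀ s, Function.Periodic (A s) (2 * Real.pi)) :
    ∫⁻ s in period, ∫⁻ t in period, A s t ≤
      2 * ∫⁻ t in Ioo 0 Real.pi, ∫⁻ s in period, A s (s + t) := by
  have hpi := Real.pi_pos
  have h1 : ∀ t, Function.Periodic (fun s => A s t) (2 * Real.pi) := fun t s => by
    simp only [hcomm _ t]; exact h2 t s
  set k : ℝ → ℝ≥0∞ := fun t => ∫⁻ s in period, A s (s + t) with hk
  have hA' : Measurable (Function.uncurry fun t s => A s (s + t)) :=
    hA.comp (by fun_prop : Measurable fun p : ℝ × ℝ => (p.2, p.2 + p.1))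
  have heven : ∀ t, k (-t) = k t := by
    intro t
    have := lintegral_period_add (F := fun s => A s (s + -t)) (fun s => by
      simp only
      rw [show s + 2 * Real.pi + -t = (s + -t) + 2 * Real.pi by ring, h2]
      exact h1 _ s) t
    simp only [hk]
    rw [← this]
    refine lintegral_congr fun s => ?_
    rw [hcomm]
    congr 1
    ring
  have e1 : ∫⁻ s in period, ∫⁻ t in period, A s t = ∫⁻ t in period, k t := by
    simp only [hk]
    rw [lintegral_lintegral_swap hA'.aemeasurable]
    refine lintegral_congr fun s => ?_
    rw [← lintegral_period_add (h2 s) s]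
    simp only [add_comm s]
  have e2 : ∫⁻ t in Ioc (-Real.pi) 0, k t = ∫⁻ t in Ioo 0 Real.pi, k t := by
    have := (Measure.measurePreserving_neg (volume : Measure ℝ)).setLIntegral_comp_preimage_emb
      (Homeomorph.neg ℝ).measurableEmbedding k (Ioc (-Real.pi) 0)
    rw [← this]
    simp only [heven]
    rw [restrict_Ioo_eq_restrict_Ico]
    congr 2
    ext t
    simp [and_comm]
  rw [e1, period, ← Ioc_union_Ioc_eq_Ioc (neg_nonpos.2 hpi.le) hpi.le, two_mul]
  refine (lintegral_union_le _ _ _).trans (le_of_eq ?_)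
  rw [e2, restrict_Ioo_eq_restrict_Ioc]

/-- The integrand is τ^(p-2), integrable at 0 because p > 1. This finite number is the constant in
the Hardy inequality. -/
theorem lintegral_rpow_mul_inv_sq_lt_top {p : ℝ} (hp : 1 < p) :
    ∫⁻ τ in Ioc (0 : ℝ) 1, ENNReal.ofReal (τ ^ p) * ENNReal.ofReal (τ ^ 2)⁻¹ < ⊤ := by
  have hint : IntegrableOn (fun τ : ℝ => τ ^ (p - 2)) (Ioc 0 1) := by
    have := intervalIntegral.intervalIntegrable_rpow' (a := 0) (b := 1) (r := p - 2) (by linarith)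
    rwa [intervalIntegrable_iff_integrableOn_Ioc_of_le zero_le_one] at this
  refine lt_of_eq_of_lt (setLIntegral_congr_fun measurableSet_Ioc fun τ hτ => ?_)
    hint.lintegral_lt_top
  rw [← ENNReal.ofReal_mul (Real.rpow_nonneg hτ.1.le _), Real.rpow_sub hτ.1, div_eq_mul_inv]
  norm_num

/-- A modular form of Hardy's inequality. -/
theorem lintegral_hardy_le {M : ℝ → ℝ → ℝ≥0∞} (hM : Measurable (Function.uncurry M))
    (hper : ∀ y, Function.Periodic (fun s => M s y) (2 * Real.pi)) (p : ℝ) {a : ℝ}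
    (ha : 0 ≤ a) {c : ℝ → ℝ → ℝ} (hc : Measurable (Function.uncurry c)) :
    ∫⁻ d in Ioo 0 a, ∫⁻ s in period, ∫⁻ τ in Ioc (0 : ℝ) 1,
        ENNReal.ofReal (τ ^ p) * M (s + c τ d) (τ ^ 2 * d) ≤
      (∫⁻ τ in Ioc (0 : ℝ) 1, ENNReal.ofReal (τ ^ p) * ENNReal.ofReal (τ ^ 2)⁻¹) *
        ∫⁻ y in Ioo 0 a, ∫⁻ s in period, M s y := by
  have hpow : Measurable fun τ : ℝ => ENNReal.ofReal (τ ^ p) := by fun_prop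
  set F : ℝ → ℝ≥0∞ := fun y => ∫⁻ s in period, M s y with hF
  have hFm : Measurable F := (hM.comp measurable_swap).lintegral_prod_right'
  have e1 : ∀ d, ∫⁻ s in period, ∫⁻ τ in Ioc (0 : ℝ) 1,
      ENNReal.ofReal (τ ^ p) * M (s + c τ d) (τ ^ 2 * d) =
      ∫⁻ τ in Ioc (0 : ℝ) 1, ENNReal.ofReal (τ ^ p) * F (τ ^ 2 * d) := by
    intro d
    -- After the swap τ and d are fixed, and the angular shift c τ d disappears by periodicity.
    rw [lintegral_lintegral_swap]
    · refine lintegral_congr fun τ => ?_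
      rw [lintegral_const_mul' _ _ ENNReal.ofReal_ne_top,
        lintegral_period_add (hper (τ ^ 2 * d))]
    · have hm : Measurable fun q : ℝ × ℝ => (q.1 + c q.2 d, q.2 ^ 2 * d) := by
        refine Measurable.prodMk (measurable_fst.add ?_) (by fun_prop)
        exact hc.comp (by fun_prop : Measurable fun q : ℝ × ℝ => (q.2, d))
      exact ((hpow.comp measurable_snd).mul (hM.comp hm)).aemeasurable
  simp only [e1]
  rw [lintegral_lintegral_swap]
  swap
  · exact ((hpow.comp measurable_snd).mul (hFm.comp (by fun_prop :
      Measurable fun q : ℝ × ℝ => q.2 ^ 2 * q.1))).aemeasurable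
  rw [← lintegral_mul_const]
  swap
  · exact hpow.mul (by fun_prop)
  -- For fixed τ the substitution y = τ²d produces the factor τ⁻² and shrinks the range of
  -- integration, since τ ≤ 1.
  refine setLIntegral_mono' measurableSet_Ioc fun τ hτ => ?_
  have hτ2 : 0 < τ ^ 2 := pow_pos hτ.1 2
  rw [lintegral_const_mul' _ _ ENNReal.ofReal_ne_top, lintegral_Ioo_comp_mul hτ2 a F, mul_assoc]
  gcongr
  have : τ ^ 2 ≤ 1 := pow_le_one₀ hτ.1.le hτ.2
  nlinarith

/-- The norm of the differential of `f` in polar coordinates. -/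
def polarDeriv (f : ℂ → ℂ) (x y : ℝ) : ℝ := ‖fderiv ℝ f (((1 - y : ℝ) : ℂ) * Circle.exp x)‖

theorem continuous_polarDeriv {f : ℂ → ℂ} (hf : ContDiff ℝ 1 f) :
    Continuous (Function.uncurry (polarDeriv f)) := by
  have h1 := hf.continuous_fderiv one_ne_zero
  have h2 : Continuous fun p : ℝ × ℝ => ((1 - p.2 : ℝ) : ℂ) * Circle.exp p.1 := by fun_prop
  exact (h1.comp h2).norm

theorem polarDeriv_periodic (f : ℂ → ℂ) (y : ℝ) :
    Function.Periodic (fun x => polarDeriv f x y) (2 * Real.pi) := fun x => by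
  simp only [polarDeriv, Circle.exp_add, Circle.exp_two_pi, mul_one]

/-- The fundamental theorem of calculus along a segment in polar coordinates with depth τ²d. The
quadratic parametrization puts a factor τ into the speed, which (aInc)ₚ later turns into τ^p. -/
theorem norm_sub_le_integral_polarDeriv {f : ℂ → ℂ} (hf : ContDiff ℝ 1 f) {ε : ℝ}
    (hε : |ε| = 1) (s : ℝ) {d : ℝ} (hd0 : 0 ≤ d) (hd1 : d ≤ 1) :
    ‖f (((1 - d : ℝ) : ℂ) * Circle.exp (s + ε * d)) - f (Circle.exp s)‖ ≤
      d * ∫ τ in (0 : ℝ)..1, τ * (4 * polarDeriv f (s + ε * (τ ^ 2 * d)) (τ ^ 2 * d)) := by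
  let γ : ℝ → ℂ := fun τ => ((1 - τ ^ 2 * d : ℝ) : ℂ) * Circle.exp (s + ε * (τ ^ 2 * d))
  let γ' : ℝ → ℂ := fun τ => ((2 * τ * d : ℝ) : ℂ) *
    ((-1 + ((1 - τ ^ 2 * d : ℝ) : ℂ) * (ε * Complex.I)) * Circle.exp (s + ε * (τ ^ 2 * d)))
  have hγ : ∀ τ, HasDerivAt γ (γ' τ) τ := by
    intro τ
    have a1 : HasDerivAt (fun τ : ℝ => 1 - τ ^ 2 * d) (-(2 * τ * d)) τ := by
      have := ((hasDerivAt_pow 2 τ).mul_const d).const_sub 1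
      simpa using this
    have a2 : HasDerivAt (fun τ : ℝ => s + ε * (τ ^ 2 * d)) (ε * (2 * τ * d)) τ := by
      have := (((hasDerivAt_pow 2 τ).mul_const d).const_mul ε).const_add s
      simpa using this
    have a3 := (a2.ofReal_comp.mul_const Complex.I).cexp
    have a4 := a1.ofReal_comp.mul a3
    have e : γ = (fun y : ℝ => ((1 - y ^ 2 * d : ℝ) : ℂ)) *
        fun x : ℝ => Complex.exp (((s + ε * (x ^ 2 * d) : ℝ) : ℂ) * Complex.I) := by
      funext τ
      simp only [γ, Circle.coe_exp, Pi.mul_apply]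
    rw [e]
    refine a4.congr_deriv ?_
    simp only [γ', Circle.coe_exp]
    push_cast
    ring
  have hγc : Continuous γ := by fun_prop
  have hγ'c : Continuous γ' := by fun_prop
  -- Speed 2τd in each of the radial and angular directions, the radius being at most 1.
  have hγn : ∀ τ ∈ Icc (0 : ℝ) 1, ‖γ' τ‖ ≤ 4 * τ * d := by
    intro τ hτ
    have b1 : τ ^ 2 * d ≤ 1 := by nlinarith [pow_le_one₀ (n := 2) hτ.1 hτ.2, sq_nonneg τ]
    have b2 : 0 ≤ τ ^ 2 * d := by positivity
    have b3 : ‖-1 + ((1 - τ ^ 2 * d : ℝ) : ℂ) * (ε * Complex.I)‖ ≤ 2 := by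
      refine (norm_add_le _ _).trans ?_
      rw [norm_neg, norm_one, norm_mul, norm_mul, Complex.norm_I, Complex.norm_real,
        Complex.norm_real, Real.norm_eq_abs, Real.norm_eq_abs, hε, abs_of_nonneg (by linarith)]
      linarith
    have b4 : 0 ≤ 2 * τ * d := by have := hτ.1; positivity
    simp only [γ']
    rw [norm_mul, norm_mul, Circle.norm_coe, mul_one, Complex.norm_real, Real.norm_of_nonneg b4]
    nlinarith
  have hder : ∀ τ ∈ uIcc (0 : ℝ) 1, HasDerivAt (fun τ => f (γ τ)) (fderiv ℝ f (γ τ) (γ' τ)) τ :=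
    fun τ _ => ((hf.differentiable one_ne_zero) (γ τ)).hasFDerivAt.comp_hasDerivAt τ (hγ τ)
  have hDc : Continuous fun τ => fderiv ℝ f (γ τ) (γ' τ) :=
    ((hf.continuous_fderiv one_ne_zero).comp hγc).clm_apply hγ'c
  have hN : Continuous fun τ : ℝ =>
      τ * (4 * polarDeriv f (s + ε * (τ ^ 2 * d)) (τ ^ 2 * d)) := by
    have := (continuous_polarDeriv hf).comp
      (by fun_prop : Continuous fun τ : ℝ => (s + ε * (τ ^ 2 * d), τ ^ 2 * d))
    exact continuous_id.mul (continuous_const.mul this)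
  have hFTC := intervalIntegral.integral_eq_sub_of_hasDerivAt hder (hDc.intervalIntegrable 0 1)
  have e0 : γ 0 = Circle.exp s := by simp [γ]
  have e1 : γ 1 = ((1 - d : ℝ) : ℂ) * Circle.exp (s + ε * d) := by simp [γ]
  rw [← e1, ← e0, ← hFTC, ← intervalIntegral.integral_const_mul]
  refine intervalIntegral.norm_integral_le_of_norm_le zero_le_one ?_
    ((continuous_const.mul hN).intervalIntegrable 0 1)
  refine Eventually.of_forall fun τ hτ => ?_
  have h1 := (fderiv ℝ f (γ τ)).le_opNorm (γ' τ)
  have h2 := hγn τ ⟨hτ.1.le, hτ.2⟩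
  have h3 := mul_le_mul_of_nonneg_left h2 (norm_nonneg (fderiv ℝ f (γ τ)))
  have h4 : polarDeriv f (s + ε * (τ ^ 2 * d)) (τ ^ 2 * d) = ‖fderiv ℝ f (γ τ)‖ := rfl
  rw [h4]
  linarith

/-- The weighted mean of `Φ(|Df|)` over the segment, in polar coordinates, which starts at the
boundary point `exp (i s)` in the direction `(ε, 1)` and ends at distance `d` from the circle. -/
def segmentMean (Φ : ℝ≥0 → ℝ≥0) (p : ℝ) (f : ℂ → ℂ) (ε s d : ℝ) : ℝ≥0∞ :=
  ∫⁻ τ in Ioc (0 : ℝ) 1, ENNReal.ofReal (τ ^ p) *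
    modular Φ (polarDeriv f (s + ε * (τ ^ 2 * d)) (τ ^ 2 * d))

/-- Jensen on the unit interval moves Φ inside the mean; (aInc)ₚ then handles the factor τ and
doubling the factor 4. -/
theorem modular_segment_le {Φ : ℝ≥0 → ℝ≥0} (hΦ : IsNFunction Φ) {p : ℝ} {A B : ℝ≥0}
    (hA : ∀ τ x, 0 < τ → τ ≤ 1 → 0 ≤ x →
      modular Φ (τ * x) ≤ A * ENNReal.ofReal (τ ^ p) * modular Φ x + A)
    (hB : ∀ x, 0 ≤ x → modular Φ (4 * x) ≤ B * modular Φ x) {f : ℂ → ℂ} (hf : ContDiff ℝ 1 f)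
    {ε : ℝ} (hε : |ε| = 1) (s : ℝ) {d : ℝ} (hd0 : 0 < d) (hd1 : d ≤ 1) :
    modular Φ (‖f (((1 - d : ℝ) : ℂ) * Circle.exp (s + ε * d)) - f (Circle.exp s)‖ / d) ≤
      A * B * segmentMean Φ p f ε s d + A := by
  have h1 := norm_sub_le_integral_polarDeriv hf hε s hd0.le hd1
  have hN : Continuous fun τ : ℝ =>
      τ * (4 * polarDeriv f (s + ε * (τ ^ 2 * d)) (τ ^ 2 * d)) := by
    have := (continuous_polarDeriv hf).comp
      (by fun_prop : Continuous fun τ : ℝ => (s + ε * (τ ^ 2 * d), τ ^ 2 * d))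
    exact continuous_id.mul (continuous_const.mul this)
  have : IsProbabilityMeasure (volume.restrict (Ioc (0 : ℝ) 1)) := ⟨by simp⟩
  have hpd : ∀ x y, 0 ≤ polarDeriv f x y := fun x y => norm_nonneg _
  calc _ ≤ modular Φ (∫ τ in (0 : ℝ)..1,
        τ * (4 * polarDeriv f (s + ε * (τ ^ 2 * d)) (τ ^ 2 * d))) := by
        refine hΦ.modular_mono ?_
        rw [div_le_iff₀ hd0]
        exact h1.trans_eq (mul_comm _ _)
    _ ≤ ∫⁻ τ in Ioc (0 : ℝ) 1,
        modular Φ (τ * (4 * polarDeriv f (s + ε * (τ ^ 2 * d)) (τ ^ 2 * d))) := by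
        rw [intervalIntegral.integral_of_le zero_le_one]
        refine hΦ.modular_integral_le (hN.integrableOn_Ioc) ?_
        refine ae_restrict_of_forall_mem measurableSet_Ioc fun τ hτ => ?_
        have := hτ.1
        have := hpd (s + ε * (τ ^ 2 * d)) (τ ^ 2 * d)
        positivity
    _ ≤ ∫⁻ τ in Ioc (0 : ℝ) 1, (A * B * (ENNReal.ofReal (τ ^ p) *
        modular Φ (polarDeriv f (s + ε * (τ ^ 2 * d)) (τ ^ 2 * d))) + A) := by
        refine setLIntegral_mono' measurableSet_Ioc fun τ hτ => ?_
        refine (hA τ _ hτ.1 hτ.2 (mul_nonneg (by norm_num) (hpd _ _))).trans ?_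
        gcongr ?_ + _
        calc _ ≤ A * ENNReal.ofReal (τ ^ p) *
              (B * modular Φ (polarDeriv f (s + ε * (τ ^ 2 * d)) (τ ^ 2 * d))) := by
              gcongr; exact hB _ (hpd _ _)
          _ = _ := by ring
    _ = _ := by
        rw [lintegral_add_right _ measurable_const,
          lintegral_const_mul' _ _ (by finiteness), lintegral_const, measure_univ, mul_one, segmentMean]

theorem lintegral_polarDeriv_le {Φ : ℝ≥0 → ℝ≥0} (hΦ : IsNFunction Φ) (f : ℂ → ℂ) :
    ∫⁻ y in Ioo (0 : ℝ) (1 / 2), ∫⁻ s in period, modular Φ (polarDeriv f s y) ≤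
      2 * ∫⁻ z in disk, modular Φ ‖fderiv ℝ f z‖ := by
  have hm : Measurable fun z => modular Φ ‖fderiv ℝ f z‖ :=
    hΦ.measurable_modular.comp (measurable_fderiv ℝ f).norm
  rw [lintegral_disk hm, ← lintegral_const_mul' _ _ ENNReal.ofNat_ne_top]
  refine le_trans ?_ (lintegral_mono_set (Ioo_subset_Ioo_right (by norm_num : (1 / 2 : ℝ) ≤ 1)))
  refine setLIntegral_mono' measurableSet_Ioo fun y hy => ?_
  rw [← lintegral_const_mul' _ _ ENNReal.ofNat_ne_top]
  refine lintegral_mono fun s => ?_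
  rw [← mul_assoc]
  refine le_mul_of_one_le_left zero_le ?_
  have : (2 : ℝ≥0∞) = ENNReal.ofReal 2 := by norm_num
  rw [this, ← ENNReal.ofReal_mul (by norm_num), ENNReal.one_le_ofReal]
  linarith [hy.2]

theorem measurable_segmentMean {Φ : ℝ≥0 → ℝ≥0} (hΦ : IsNFunction Φ) (p : ℝ) {f : ℂ → ℂ}
    (hf : ContDiff ℝ 1 f) (ε : ℝ) : Measurable fun q : ℝ × ℝ => segmentMean Φ p f ε q.1 q.2 := by
  have hMm := hΦ.measurable_modular.comp (continuous_polarDeriv hf).measurable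
  have hpow : Measurable fun τ : ℝ => ENNReal.ofReal (τ ^ p) := by fun_prop
  have h : Measurable fun q : (ℝ × ℝ) × ℝ =>
      (q.1.1 + ε * (q.2 ^ 2 * q.1.2), q.2 ^ 2 * q.1.2) := by fun_prop
  have hM := hMm.comp h
  have hm : Measurable fun q : (ℝ × ℝ) × ℝ => ENNReal.ofReal (q.2 ^ p) *
      modular Φ (polarDeriv f (q.1.1 + ε * (q.2 ^ 2 * q.1.2)) (q.2 ^ 2 * q.1.2)) :=
    (hpow.comp measurable_snd).mul hM
  have := hm.lintegral_prod_right' (ν := volume.restrict (Ioc (0 : ℝ) 1))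
  exact this

/-- The starting point may itself drift with d, at rate b, since the Hardy inequality admits any
measurable angular shift. The case b = 2 serves the second endpoint s + 2d. -/
theorem lintegral_segmentMean_le {Φ : ℝ≥0 → ℝ≥0} (hΦ : IsNFunction Φ) (p : ℝ) {f : ℂ → ℂ}
    (hf : ContDiff ℝ 1 f) (ε b : ℝ) :
    ∫⁻ d in Ioo (0 : ℝ) (1 / 2), ∫⁻ s in period, segmentMean Φ p f ε (s + b * d) d ≤
      (∫⁻ τ in Ioc (0 : ℝ) 1, ENNReal.ofReal (τ ^ p) * ENNReal.ofReal (τ ^ 2)⁻¹) *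
        (2 * ∫⁻ z in disk, modular Φ ‖fderiv ℝ f z‖) := by
  have hMm : Measurable (Function.uncurry fun x y => modular Φ (polarDeriv f x y)) :=
    hΦ.measurable_modular.comp (continuous_polarDeriv hf).measurable
  have hper : ∀ y, Function.Periodic (fun s => modular Φ (polarDeriv f s y)) (2 * Real.pi) :=
    fun y s => congrArg (modular Φ) (polarDeriv_periodic f y s)
  have := lintegral_hardy_le hMm hper p (a := 1 / 2) (by norm_num)
    (c := fun τ d => b * d + ε * (τ ^ 2 * d)) (by unfold Function.uncurry; fun_prop)
  simp only [← add_assoc] at this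
  exact this.trans (mul_le_mul_right (lintegral_polarDeriv_le hΦ f) _)

theorem douglasKernel_le_of_one_le {Φ : ℝ≥0 → ℝ≥0} (hΦ : IsNFunction Φ) {φ : Circle → ℂ}
    (hb : ∀ ξ, ‖φ ξ‖ ≤ 1) (s : ℝ) {t : ℝ} (ht1 : 1 ≤ t) (ht2 : t ≤ Real.pi) :
    douglasKernel Φ φ s (s + t) ≤ modular Φ 4 := by
  refine hΦ.modular_mono ?_
  have h1 := abs_sub_le_norm_exp_sub_exp (s := s) (t := s + t)
    (by rw [sub_add_cancel_left, abs_neg, abs_of_pos (by linarith)]; exact ht2)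
  rw [sub_add_cancel_left, abs_neg, abs_of_pos (by linarith)] at h1
  rw [norm_div, div_le_iff₀ (by linarith)]
  have h2 := (norm_sub_le (φ (Circle.exp s)) (φ (Circle.exp (s + t)))).trans
    (add_le_add (hb _) (hb _))
  linarith

/-- The boundary points at angles s and s + 2d are compared through the interior point at angle s +
d and depth d, reached from them in the directions ε = 1 and ε = -1. The chord between them is at
least d. -/
theorem douglasKernel_le_segmentMean {Φ : ℝ≥0 → ℝ≥0} (hΦ : IsNFunction Φ) {p : ℝ} {A B D : ℝ≥0}
    (hA : ∀ τ x, 0 < τ → τ ≤ 1 → 0 ≤ x →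
      modular Φ (τ * x) ≤ A * ENNReal.ofReal (τ ^ p) * modular Φ x + A)
    (hB : ∀ x, 0 ≤ x → modular Φ (4 * x) ≤ B * modular Φ x)
    (hD : ∀ x y, 0 ≤ x → 0 ≤ y → modular Φ (x + y) ≤ D * (modular Φ x + modular Φ y))
    {f : ℂ → ℂ} (hf : ContDiff ℝ 1 f) (s : ℝ) {d : ℝ} (hd0 : 0 < d) (hd1 : d ≤ 1) :
    douglasKernel Φ (fun ξ => f ξ) s (s + 2 * d) ≤
      D * ((A * B * segmentMean Φ p f 1 s d + A) +
        (A * B * segmentMean Φ p f (-1) (s + 2 * d) d + A)) := by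
  have a1 := modular_segment_le hΦ hA hB hf (ε := 1) abs_one s hd0 hd1
  have a2 := modular_segment_le hΦ hA hB hf (ε := -1) (by simp) (s + 2 * d) hd0 hd1
  rw [show s + 2 * d + -1 * d = s + 1 * d by ring] at a2
  set w := f (((1 - d : ℝ) : ℂ) * Circle.exp (s + 1 * d))
  have h1 := abs_sub_le_norm_exp_sub_exp (s := s) (t := s + 2 * d)
    (by rw [sub_add_cancel_left, abs_neg, abs_of_pos (by linarith)]; linarith [Real.pi_gt_three])
  rw [sub_add_cancel_left, abs_neg, abs_of_pos (by linarith)] at h1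
  have h2 : ‖(f (Circle.exp s) - f (Circle.exp (s + 2 * d))) /
      ((Circle.exp s : ℂ) - Circle.exp (s + 2 * d))‖ ≤
      ‖w - f (Circle.exp s)‖ / d + ‖w - f (Circle.exp (s + 2 * d))‖ / d := by
    rw [norm_div, ← add_div]
    refine div_le_div₀ (by positivity) ?_ hd0 (by linarith)
    rw [norm_sub_rev w (f (Circle.exp s))]
    exact norm_sub_le_norm_sub_add_norm_sub _ _ _
  calc _ ≤ _ := hΦ.modular_mono h2
    _ ≤ _ := hD _ _ (by positivity) (by positivity)
    _ ≤ _ := by gcongr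

theorem measurable_slice_and_lintegral {α β : Type*} [MeasurableSpace α] [MeasurableSpace β]
    {S : α → β → ℝ≥0∞} (hS : Measurable fun q : α × β => S q.1 q.2) (μ : Measure α) [SFinite μ] :
    (∀ d, Measurable fun s => S s d) ∧ Measurable fun d => ∫⁻ s, S s d ∂μ :=
  ⟨fun _ => hS.comp measurable_prodMk_right, hS.lintegral_prod_left'⟩

theorem lintegral_lintegral_affine_le {α β : Type*} [MeasurableSpace α] [MeasurableSpace β]
    {μ : Measure α} {ν : Measure β} {S T : β → α → ℝ≥0∞}
    (hS : ∀ d, Measurable (S d)) (hS' : Measurable fun d => ∫⁻ s, S d s ∂μ)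
    {c a D J : ℝ≥0∞} (hc : c ≠ ⊤) (hD : D ≠ ⊤)
    (hSJ : ∫⁻ d, ∫⁻ s, S d s ∂μ ∂ν ≤ J) (hTJ : ∫⁻ d, ∫⁻ s, T d s ∂μ ∂ν ≤ J) :
    ∫⁻ d, ∫⁻ s, D * ((c * S d s + a) + (c * T d s + a)) ∂μ ∂ν ≤
      D * (2 * (a * μ univ * ν univ)) + D * (2 * (c * J)) := by
  have hin : ∀ d, ∫⁻ s, D * ((c * S d s + a) + (c * T d s + a)) ∂μ =
      D * ((c * (∫⁻ s, S d s ∂μ) + a * μ univ) + (c * (∫⁻ s, T d s ∂μ) + a * μ univ)) := by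
    intro d
    rw [lintegral_const_mul' _ _ hD, lintegral_add_left (((hS d).const_mul _).add_const _),
      lintegral_add_right _ measurable_const, lintegral_add_right _ measurable_const,
      lintegral_const_mul' _ _ hc, lintegral_const_mul' _ _ hc, lintegral_const]
  simp only [hin]
  rw [lintegral_const_mul' _ _ hD, lintegral_add_left ((hS'.const_mul _).add_const _),
    lintegral_add_right _ measurable_const, lintegral_add_right _ measurable_const,
    lintegral_const_mul' _ _ hc, lintegral_const_mul' _ _ hc, lintegral_const]
  calc _ ≤ D * ((c * J + a * μ univ * ν univ) + (c * J + a * μ univ * ν univ)) :=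
        mul_le_mul_right (add_le_add (add_le_add_left (mul_le_mul_right hSJ _) _)
          (add_le_add_left (mul_le_mul_right hTJ _) _)) _
    _ = _ := by ring

theorem lintegral_douglasKernel_near_le {Φ : ℝ≥0 → ℝ≥0} (hΦ : IsNFunction Φ) {p : ℝ} {A B D : ℝ≥0}
    (hA : ∀ τ x, 0 < τ → τ ≤ 1 → 0 ≤ x →
      modular Φ (τ * x) ≤ A * ENNReal.ofReal (τ ^ p) * modular Φ x + A)
    (hB : ∀ x, 0 ≤ x → modular Φ (4 * x) ≤ B * modular Φ x)
    (hD : ∀ x y, 0 ≤ x → 0 ≤ y → modular Φ (x + y) ≤ D * (modular Φ x + modular Φ y))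
    {f : ℂ → ℂ} (hf : ContDiff ℝ 1 f) {K I : ℝ≥0∞}
    (hK : ∫⁻ τ in Ioc (0 : ℝ) 1, ENNReal.ofReal (τ ^ p) * ENNReal.ofReal (τ ^ 2)⁻¹ = K)
    (hI : ∫⁻ z in disk, modular Φ ‖fderiv ℝ f z‖ = I) :
    ∫⁻ d in Ioo (0 : ℝ) (1 / 2), ∫⁻ s in period, douglasKernel Φ (fun ξ => f ξ) s (s + 2 * d) ≤
      D * (2 * (A * volume period * volume (Ioo (0 : ℝ) (1 / 2)))) +
        D * (2 * (A * B * (K * (2 * I)))) := by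
  have hS1 := lintegral_segmentMean_le hΦ p hf 1 0
  have hS2 := lintegral_segmentMean_le hΦ p hf (-1) 2
  simp only [zero_mul, add_zero] at hS1
  rw [hK, hI] at hS1 hS2
  have hSm := measurable_segmentMean hΦ p hf 1
  obtain ⟨hSs, hSd⟩ := measurable_slice_and_lintegral hSm (volume.restrict period)
  have hAB : (A * B : ℝ≥0∞) ≠ ⊤ := by finiteness
  have h := lintegral_lintegral_affine_le hSs hSd (a := A) hAB (D := D) ENNReal.coe_ne_top hS1 hS2
  rw [Measure.restrict_apply_univ, Measure.restrict_apply_univ] at h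
  refine le_trans ?_ h
  refine setLIntegral_mono' measurableSet_Ioo fun d hd => lintegral_mono fun s => ?_
  have hd1 : d ≤ 1 := by linarith [hd.2]
  exact douglasKernel_le_segmentMean hΦ hA hB hD hf s hd.1 hd1

/-- A priori estimate: the Douglas integral of the trace of a smooth map is controlled by the
modular of its differential. -/
theorem exists_lintegral_douglasKernel_le {Φ : ℝ≥0 → ℝ≥0} (hΦ : IsNFunction Φ)
    (hd : IsDoubling Φ) {p : ℝ} (hp : 1 < p) {t₀ : ℝ≥0} (hi : IsAInc Φ p t₀) :
    ∃ C : ℝ≥0∞, C < ⊤ ∧ ∀ f : ℂ → ℂ, ContDiff ℝ 1 f → (∀ ξ : Circle, ‖f ξ‖ ≤ 1) →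
      ∫⁻ s in period, ∫⁻ t in period, douglasKernel Φ (fun ξ => f ξ) s t ≤
        C + C * ∫⁻ z in disk, modular Φ ‖fderiv ℝ f z‖ := by
  obtain ⟨A, hA⟩ := hΦ.modular_mul_le_of_aInc hi
  obtain ⟨B, hB⟩ := hΦ.modular_const_mul_le hd 4
  obtain ⟨D, hD⟩ := hΦ.modular_add_le hd
  obtain ⟨K, hK⟩ : ∃ K, ∫⁻ τ in Ioc (0 : ℝ) 1,
    ENNReal.ofReal (τ ^ p) * ENNReal.ofReal (τ ^ 2)⁻¹ = K := ⟨_, rfl⟩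
  have hKtop : K < ⊤ := hK ▸ lintegral_rpow_mul_inv_sq_lt_top hp
  obtain ⟨L, hL⟩ : ∃ L, volume period = L := ⟨_, rfl⟩
  have hLtop : L < ⊤ := hL ▸ measure_Ioc_lt_top
  obtain ⟨V, hV⟩ : ∃ V, volume (Ico 1 Real.pi) = V := ⟨_, rfl⟩
  have hVtop : V < ⊤ := hV ▸ measure_Ico_lt_top
  obtain ⟨W, hW⟩ : ∃ W, volume (Ioo (0 : ℝ) (1 / 2)) = W := ⟨_, rfl⟩
  have hWtop : W < ⊤ := hW ▸ measure_Ioo_lt_top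
  obtain ⟨m, hm⟩ : ∃ m, modular Φ 4 = m := ⟨_, rfl⟩
  have hmtop : m < ⊤ := hm ▸ modular_lt_top Φ 4
  have hpi := Real.pi_gt_three
  -- One constant must serve as both additive and multiplicative bound, hence the maximum of the
  -- two; each doubles for the symmetry t ↦ -t.
  refine ⟨max (2 * (m * L * V + 2 * (D * (2 * (A * L * W)))))
    (2 * (2 * (D * (2 * (A * B * (K * 2)))))), max_lt (by finiteness) (by finiteness),
    fun f hf hb => ?_⟩
  obtain ⟨I, hI⟩ : ∃ I, ∫⁻ z in disk, modular Φ ‖fderiv ℝ f z‖ = I := ⟨_, rfl⟩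
  have hnear := lintegral_douglasKernel_near_le hΦ hA hB hD hf hK hI
  have hfc := hf.continuous
  have hφ : Continuous fun ξ : Circle => f ξ := by fun_prop
  have hfar : ∀ s t, 1 ≤ t → t ≤ Real.pi → douglasKernel Φ (fun ξ => f ξ) s (s + t) ≤ m :=
    fun s t h1 h2 => hm ▸ douglasKernel_le_of_one_le hΦ hb s h1 h2
  rw [hL, hW] at hnear
  rw [hI]
  generalize (fun ξ : Circle => f ξ) = φ at *
  refine (lintegral_lintegral_le_of_symmetric (measurable_douglasKernel hΦ hφ)
    (douglasKernel_comm Φ φ) (douglasKernel_periodic_right Φ φ)).trans ?_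
  rw [← Ioo_union_Ico_eq_Ioo zero_lt_one (by linarith : 1 ≤ Real.pi)]
  have hscale := lintegral_Ioo_comp_mul two_pos (1 / 2)
    (fun t => ∫⁻ s in period, douglasKernel Φ φ s (s + t))
  rw [show (2 : ℝ) * (1 / 2) = 1 by norm_num] at hscale
  -- The offset between the two angles is t = 2d, so offsets below 1 correspond to depths below 1/2.
  have hscale' : ∫⁻ t in Ioo (0 : ℝ) 1, ∫⁻ s in period, douglasKernel Φ φ s (s + t) =
      2 * ∫⁻ d in Ioo (0 : ℝ) (1 / 2), ∫⁻ s in period, douglasKernel Φ φ s (s + 2 * d) := by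
    rw [hscale, ← mul_assoc]
    have : (2 : ℝ≥0∞) * ENNReal.ofReal 2⁻¹ = 1 := by
      rw [ENNReal.ofReal_inv_of_pos two_pos, ENNReal.ofReal_ofNat]
      exact ENNReal.mul_inv_cancel two_ne_zero ENNReal.ofNat_ne_top
    rw [this, one_mul]
  have hfarint : ∫⁻ t in Ico 1 Real.pi, ∫⁻ s in period, douglasKernel Φ φ s (s + t) ≤
      m * L * V := by
    calc _ ≤ ∫⁻ t in Ico 1 Real.pi, ∫⁻ s in period, m :=
          setLIntegral_mono' measurableSet_Ico fun t ht => lintegral_mono fun s =>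
            hfar s t ht.1 ht.2.le
      _ = _ := by simp only [lintegral_const, Measure.restrict_apply_univ, hL, hV]
  calc _ ≤ 2 * (2 * (D * (2 * (A * L * W)) + D * (2 * (A * B * (K * (2 * I))))) + m * L * V) := by
        refine mul_le_mul_right ((lintegral_union_le _ _ _).trans (add_le_add ?_ hfarint)) _
        rw [hscale']
        exact mul_le_mul_right hnear _
    _ = 2 * (m * L * V + 2 * (D * (2 * (A * L * W)))) +
        2 * (2 * (D * (2 * (A * B * (K * 2))))) * I := by ring
    _ ≤ _ := by gcongr; exacts [le_max_left _ _, le_max_right _ _]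

/-! ### Mollification of weakly differentiable maps -/

theorem integrableOn_normed_smul (ρ : ContDiffBump (0 : ℂ)) {E : Type*} [NormedAddCommGroup E]
    [NormedSpace ℝ E] {Ω : Set ℂ} {g : ℂ → E} (hg : IntegrableOn g Ω) (x : ℂ) :
    IntegrableOn (fun w => ρ.normed volume (x - w) • g w) Ω := by
  have hc : Continuous (ρ.normed volume) := (ρ.contDiff_normed (n := 0)).continuous
  obtain ⟨C, hC⟩ := hc.bounded_above_of_compact_support ρ.hasCompactSupport_normed
  have hm : Continuous fun w => ρ.normed volume (x - w) := by fun_prop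
  exact Integrable.bdd_smul hg C hm.aestronglyMeasurable (ae_of_all _ fun w => hC _)

/-- The mollification of a weakly differentiable map has as its differential the mollification of
the weak differential. -/
theorem HasWeakDifferential.hasFDerivAt_convolution {Ω : Set ℂ} {F : ℂ → ℂ}
    {Df : ℂ → ℂ →L[ℝ] ℂ} (h : HasWeakDifferential Ω F Df) (hF : Continuous F)
    (ρ : ContDiffBump (0 : ℂ)) {x : ℂ} (hx : Metric.closedBall x ρ.rOut ⊆ Ω) :
    HasFDerivAt (convolution (ρ.normed volume) F (ContinuousLinearMap.lsmul ℝ ℝ) volume)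
      (∫ w in Ω, ρ.normed volume (x - w) • Df w) x := by
  have hρ : ContDiff ℝ (⊤ : ℕ∞) (ρ.normed (volume : Measure ℂ)) := ρ.contDiff_normed
  have hρ1 : ContDiff ℝ 1 (ρ.normed (volume : Measure ℂ)) := ρ.contDiff_normed (n := 1)
  have hd := ρ.hasCompactSupport_normed.hasFDerivAt_convolution_left
    (ContinuousLinearMap.lsmul ℝ ℝ) hρ1 (hF.locallyIntegrable (μ := volume)) x
  refine hd.congr_fderiv (ContinuousLinearMap.ext fun v => ?_)
  -- The reflected kernel w ↦ ρ(x - w) is the test function; its support lies in the ball about x,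
  -- hence in Ω. The sign from the reflection cancels the one from integration by parts.
  have hη : ContDiff ℝ (⊤ : ℕ∞) fun w => ρ.normed volume (x - w) :=
    hρ.comp (contDiff_const.sub contDiff_id)
  have hsupp : Function.support (fun w => ρ.normed volume (x - w)) ⊆
      Metric.closedBall x ρ.rOut := fun w hw => by
    have : x - w ∈ Function.support (ρ.normed (volume : Measure ℂ)) := hw
    rw [ρ.support_normed_eq, mem_ball_zero_iff, ← dist_eq_norm, dist_comm] at this
    exact Metric.mem_closedBall.2 this.le
  have hts : tsupport (fun w => ρ.normed volume (x - w)) ⊆ Metric.closedBall x ρ.rOut :=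
    closure_minimal hsupp Metric.isClosed_closedBall
  have hη' : ∀ w, fderiv ℝ (fun w => ρ.normed volume (x - w)) w v =
      -fderiv ℝ (ρ.normed volume) (x - w) v := fun w => by
    have h1 : HasFDerivAt (ρ.normed (volume : Measure ℂ)) _ (x - w) :=
      (hρ1.differentiable one_ne_zero _).hasFDerivAt
    have h2 := h1.comp w ((hasFDerivAt_id w).const_sub x)
    rw [HasFDerivAt.fderiv (f := fun w => ρ.normed volume (x - w)) h2]
    simp
  have key := h.integral_eq _ hη (HasCompactSupport.of_support_subset_isCompact
    (isCompact_closedBall x ρ.rOut) hsupp) (hts.trans hx) v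
  rw [ContinuousLinearMap.integral_apply
    (integrableOn_normed_smul ρ h.integrableOn_differential x)]
  have hint : Integrable fun w =>
      (ContinuousLinearMap.precompL ℂ (ContinuousLinearMap.lsmul ℝ ℝ))
        (fderiv ℝ (ρ.normed volume) (x - w)) (F w) := by
    refine Continuous.integrable_of_hasCompactSupport ?_ ?_
    · have := hρ1.continuous_fderiv one_ne_zero
      fun_prop
    · refine HasCompactSupport.intro (isCompact_closedBall x ρ.rOut) fun w hw => ?_
      have : fderiv ℝ (ρ.normed (volume : Measure ℂ)) (x - w) = 0 := by
        refine Function.notMem_support.1 fun hs => hw ?_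
        have := support_fderiv_subset ℝ hs
        rw [ρ.tsupport_normed_eq, mem_closedBall_zero_iff, ← dist_eq_norm, dist_comm] at this
        exact Metric.mem_closedBall.2 this
      rw [this, map_zero, _root_.zero_apply]
  rw [convolution_eq_swap, ContinuousLinearMap.integral_apply hint]
  simp only [ContinuousLinearMap.precompL_apply, ContinuousLinearMap.lsmul_apply,
    _root_.smul_apply]
  simp only [hη', neg_smul, integral_neg, neg_inj] at key
  rw [← key]
  refine (setIntegral_eq_integral_of_forall_compl_eq_zero fun w hw => ?_).symm
  have : fderiv ℝ (fun w => ρ.normed volume (x - w)) w = 0 :=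
    Function.notMem_support.1 fun hs => hw (hx (hts (support_fderiv_subset ℝ hs)))
  have h0 := hη' w
  rw [this, _root_.zero_apply, zero_eq_neg] at h0
  rw [h0, zero_smul]

theorem lintegral_normed (ρ : ContDiffBump (0 : ℂ)) :
    ∫⁻ w, ENNReal.ofReal (ρ.normed volume w) = 1 := by
  rw [← ofReal_integral_eq_lintegral_ofReal ρ.integrable_normed
    (ae_of_all _ fun w => ρ.nonneg_normed w), ρ.integral_normed, ENNReal.ofReal_one]

theorem setLIntegral_normed_sub (ρ : ContDiffBump (0 : ℂ)) {Ω : Set ℂ} {x : ℂ}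
    (hx : Metric.closedBall x ρ.rOut ⊆ Ω) :
    ∫⁻ w in Ω, ENNReal.ofReal (ρ.normed volume (x - w)) = 1 := by
  rw [setLIntegral_eq_of_support_subset, lintegral_sub_left_eq_self
    (fun w => ENNReal.ofReal (ρ.normed volume w)), lintegral_normed]
  intro w hw
  refine hx ?_
  have : x - w ∈ Function.support (ρ.normed (volume : Measure ℂ)) := fun h0 => hw (by simp [h0])
  rw [ρ.support_normed_eq, mem_ball_zero_iff, ← dist_eq_norm, dist_comm] at this
  exact Metric.mem_closedBall.2 this.le

/-- Since the ball about x lies in Ω, the kernel is a probability density there, and Jensen applies.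
-/
theorem IsNFunction.modular_norm_mollify_le {Φ : ℝ≥0 → ℝ≥0} (hΦ : IsNFunction Φ)
    (ρ : ContDiffBump (0 : ℂ)) {E : Type*} [NormedAddCommGroup E] [NormedSpace ℝ E] {Ω : Set ℂ}
    {g : ℂ → E} (hg : IntegrableOn g Ω) {x : ℂ} (hx : Metric.closedBall x ρ.rOut ⊆ Ω) :
    modular Φ ‖∫ w in Ω, ρ.normed volume (x - w) • g w‖ ≤
      ∫⁻ w in Ω, ENNReal.ofReal (ρ.normed volume (x - w)) * modular Φ ‖g w‖ := by
  have hc : Continuous (ρ.normed (volume : Measure ℂ)) := (ρ.contDiff_normed (n := 0)).continuous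
  set δ : ℂ → ℝ≥0∞ := fun w => ENNReal.ofReal (ρ.normed volume (x - w)) with hδ
  have hδm : Measurable δ := by
    refine ENNReal.measurable_ofReal.comp (Continuous.measurable ?_)
    fun_prop
  have hδt : ∀ w, (δ w).toReal = ρ.normed volume (x - w) := fun w =>
    ENNReal.toReal_ofReal (ρ.nonneg_normed _)
  have hδl : ∀ᵐ w ∂(volume.restrict Ω), δ w < ⊤ := ae_of_all _ fun w => ENNReal.ofReal_lt_top
  have hprob : IsProbabilityMeasure ((volume.restrict Ω).withDensity δ) := ⟨by
    rw [withDensity_apply _ MeasurableSet.univ, Measure.restrict_univ]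
    exact setLIntegral_normed_sub ρ hx⟩
  have hint : Integrable (fun w => ‖g w‖) ((volume.restrict Ω).withDensity δ) := by
    rw [integrable_withDensity_iff_integrable_smul' hδm hδl]
    simp only [hδt]
    exact integrableOn_normed_smul ρ hg.norm x
  calc _ ≤ modular Φ (∫ w, ‖g w‖ ∂((volume.restrict Ω).withDensity δ)) := by
        refine hΦ.modular_mono ((norm_integral_le_integral_norm _).trans_eq ?_)
        rw [integral_withDensity_eq_integral_toReal_smul hδm hδl]
        refine integral_congr_ae (ae_of_all _ fun w => ?_)
        simp only [hδt, norm_smul, Real.norm_of_nonneg (ρ.nonneg_normed _), smul_eq_mul]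
    _ ≤ ∫⁻ w, modular Φ ‖g w‖ ∂((volume.restrict Ω).withDensity δ) :=
        hΦ.modular_integral_le hint (ae_of_all _ fun w => norm_nonneg _)
    _ = _ := lintegral_withDensity_eq_lintegral_mul_non_measurable _ hδm hδl _

theorem lintegral_comp_smul_le {g : ℂ → ℝ≥0∞} (hg : Measurable g) {r : ℝ} (hr : 1 / 2 ≤ r) :
    ∫⁻ z, g (r • z) ≤ 4 * ∫⁻ z, g z := by
  have hr0 : 0 < r := by linarith
  rw [← lintegral_map hg (measurable_const_smul r), Measure.map_addHaar_smul _ hr0.ne',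
    lintegral_smul_measure, Complex.finrank_real_complex, smul_eq_mul]
  gcongr
  rw [show (4 : ℝ≥0∞) = ENNReal.ofReal 4 by norm_num, abs_of_pos (by positivity)]
  refine ENNReal.ofReal_le_ofReal ?_
  rw [inv_le_comm₀ (by positivity) (by norm_num)]
  nlinarith

/-- Mollification at scale `ρ`, precomposed with a dilation so that only values in the unit disk
are averaged. -/
def innerMollify (ρ : ContDiffBump (0 : ℂ)) (F : ℂ → ℂ) (z : ℂ) : ℂ :=
  convolution (ρ.normed volume) F (ContinuousLinearMap.lsmul ℝ ℝ) volume ((1 - ρ.rOut) • z)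

theorem contDiff_innerMollify (ρ : ContDiffBump (0 : ℂ)) {F : ℂ → ℂ} (hF : Continuous F) :
    ContDiff ℝ 1 (innerMollify ρ F) := by
  have h := (ρ.hasCompactSupport_normed (μ := volume)).contDiff_convolution_left (n := 1)
    (ContinuousLinearMap.lsmul ℝ ℝ) ρ.contDiff_normed (hF.locallyIntegrable (μ := volume))
  exact h.comp (contDiff_const_smul (1 - ρ.rOut))

theorem norm_innerMollify_le (ρ : ContDiffBump (0 : ℂ)) {F : ℂ → ℂ} (hF1 : ∀ z, ‖F z‖ ≤ 1)
    (z : ℂ) : ‖innerMollify ρ F z‖ ≤ 1 := by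
  rw [innerMollify, convolution_def, ← ρ.integral_normed (μ := (volume : Measure ℂ))]
  refine norm_integral_le_of_norm_le ρ.integrable_normed (ae_of_all _ fun w => ?_)
  rw [ContinuousLinearMap.lsmul_apply, norm_smul, Real.norm_of_nonneg (ρ.nonneg_normed _)]
  exact mul_le_of_le_one_right (ρ.nonneg_normed _) (hF1 _)

theorem tendsto_innerMollify {ι : Type*} {l : Filter ι} {ρ : ι → ContDiffBump (0 : ℂ)}
    (hρ : Tendsto (fun i => (ρ i).rOut) l (𝓝 0)) {F : ℂ → ℂ} (hF : Continuous F) (z : ℂ) :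
    Tendsto (fun i => innerMollify (ρ i) F z) l (𝓝 (F z)) := by
  refine ContDiffBump.convolution_tendsto_right (g := fun _ => F) (x₀ := z) hρ
    (Eventually.of_forall fun _ => hF.aestronglyMeasurable) ?_ ?_
  · exact (hF.tendsto z).comp tendsto_snd
  · have : Tendsto (fun i => (1 - (ρ i).rOut) • z) l (𝓝 ((1 - 0 : ℝ) • z)) :=
      (hρ.const_sub 1).smul_const z
    simpa using this

/-- The dilation by 1 - `ρ.rOut` ≤ 1 keeps the averaging balls inside the disk and does not enlarge
the differential. After Jensen and Tonelli the only loss is the Jacobian of the dilation, at most 4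
because the factor is at least 1/2. -/
theorem HasWeakDifferential.lintegral_modular_fderiv_innerMollify_le {Φ : ℝ≥0 → ℝ≥0}
    (hΦ : IsNFunction Φ) {F : ℂ → ℂ} {Df : ℂ → ℂ →L[ℝ] ℂ} (h : HasWeakDifferential disk F Df)
    (hF : Continuous F) (ρ : ContDiffBump (0 : ℂ)) (hρ : ρ.rOut ≤ 1 / 2) :
    ∫⁻ z in disk, modular Φ ‖fderiv ℝ (innerMollify ρ F) z‖ ≤
      4 * ∫⁻ z in disk, modular Φ ‖Df z‖ := by
  have hρ0 := ρ.rOut_pos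
  have hr : 1 / 2 ≤ 1 - ρ.rOut := by linarith
  have hc : Continuous (ρ.normed (volume : Measure ℂ)) := (ρ.contDiff_normed (n := 0)).continuous
  have hM : AEMeasurable (fun w => modular Φ ‖Df w‖) (volume.restrict disk) :=
    hΦ.measurable_modular.comp_aemeasurable h.integrableOn_differential.1.norm.aemeasurable
  have hpt : ∀ z ∈ disk, modular Φ ‖fderiv ℝ (innerMollify ρ F) z‖ ≤
      ∫⁻ w in disk, ENNReal.ofReal (ρ.normed volume ((1 - ρ.rOut) • z - w)) *
        modular Φ ‖Df w‖ := by
    intro z hz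
    have hz1 : ‖z‖ < 1 := mem_ball_zero_iff.1 hz
    have hx : Metric.closedBall ((1 - ρ.rOut) • z) ρ.rOut ⊆ disk := by
      refine Metric.closedBall_subset_ball' ?_
      rw [dist_zero_right, norm_smul, Real.norm_of_nonneg (by linarith)]
      nlinarith
    have hd := (h.hasFDerivAt_convolution hF ρ hx).comp z
      ((hasFDerivAt_id (𝕜 := ℝ) z).const_smul (1 - ρ.rOut))
    have hd' : fderiv ℝ (innerMollify ρ F) z = _ := hd.fderiv
    refine le_trans (hΦ.modular_mono ?_)
      (hΦ.modular_norm_mollify_le ρ h.integrableOn_differential hx)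
    rw [hd']
    refine (ContinuousLinearMap.opNorm_comp_le _ _).trans
      (mul_le_of_le_one_right (norm_nonneg _) ?_)
    rw [norm_smul, Real.norm_of_nonneg (by linarith)]
    exact mul_le_one₀ (by linarith) (norm_nonneg _) ContinuousLinearMap.norm_id_le
  have hδ : Continuous fun q : ℂ × ℂ => ρ.normed volume ((1 - ρ.rOut) • q.1 - q.2) := by
    fun_prop
  have hδm := ENNReal.measurable_ofReal.comp hδ.measurable
  calc _ ≤ ∫⁻ z in disk, ∫⁻ w in disk,
        ENNReal.ofReal (ρ.normed volume ((1 - ρ.rOut) • z - w)) * modular Φ ‖Df w‖ :=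
        setLIntegral_mono' measurableSet_ball hpt
    _ = ∫⁻ w in disk, ∫⁻ z in disk,
        ENNReal.ofReal (ρ.normed volume ((1 - ρ.rOut) • z - w)) * modular Φ ‖Df w‖ := by
        refine lintegral_lintegral_swap ?_
        exact hδm.aemeasurable.mul hM.comp_snd
    _ ≤ ∫⁻ w in disk, 4 * modular Φ ‖Df w‖ := by
        refine lintegral_mono fun w => ?_
        rw [lintegral_mul_const' _ _ (modular_lt_top _ _).ne]
        refine mul_le_mul_left ((setLIntegral_le_lintegral _ _).trans ?_) _
        have hm : Measurable fun z => ENNReal.ofReal (ρ.normed volume (z - w)) := by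
          refine ENNReal.measurable_ofReal.comp (Continuous.measurable ?_)
          fun_prop
        refine (lintegral_comp_smul_le hm hr).trans_eq ?_
        rw [lintegral_sub_right_eq_self (fun z => ENNReal.ofReal (ρ.normed volume z)),
          lintegral_normed, mul_one]
    _ = _ := lintegral_const_mul' _ _ ENNReal.ofNat_ne_top

/-! ### Passage to the limit and the converse implication -/

/-- Fatou's lemma, applied to the inner and then to the outer integral. -/
theorem lintegral_lintegral_le_of_tendsto {α β : Type*} [MeasurableSpace α] [MeasurableSpace β]
    {μ : Measure α} {ν : Measure β} [SFinite ν] {k : ℕ → α → β → ℝ≥0∞} {k' : α → β → ℝ≥0∞}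
    (hk : ∀ n, Measurable (Function.uncurry (k n)))
    (hlim : ∀ s t, Tendsto (fun n => k n s t) atTop (𝓝 (k' s t))) {T : ℝ≥0∞}
    (hT : ∀ n, ∫⁻ s, ∫⁻ t, k n s t ∂ν ∂μ ≤ T) : ∫⁻ s, ∫⁻ t, k' s t ∂ν ∂μ ≤ T :=
  calc _ ≤ ∫⁻ s, liminf (fun n => ∫⁻ t, k n s t ∂ν) atTop ∂μ := by
        refine lintegral_mono fun s => ?_
        simp only [← fun t => (hlim s t).liminf_eq]
        exact lintegral_liminf_le fun n => (hk n).of_uncurry_left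
    _ ≤ liminf (fun n => ∫⁻ s, ∫⁻ t, k n s t ∂ν ∂μ) atTop :=
        lintegral_liminf_le fun n => (hk n).lintegral_prod_right
    _ ≤ T := (liminf_le_liminf (Eventually.of_forall hT)).trans_eq (liminf_const T)

theorem lintegral_douglasKernel_le_of_tendsto {Φ : ℝ≥0 → ℝ≥0} (hΦ : IsNFunction Φ)
    {f : ℕ → Circle → ℂ} {φ : Circle → ℂ} (hf : ∀ n, Continuous (f n))
    (hlim : ∀ ξ, Tendsto (fun n => f n ξ) atTop (𝓝 (φ ξ))) {T : ℝ≥0∞}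
    (hT : ∀ n, ∫⁻ s in period, ∫⁻ t in period, douglasKernel Φ (f n) s t ≤ T) :
    ∫⁻ s in period, ∫⁻ t in period, douglasKernel Φ φ s t ≤ T := by
  refine lintegral_lintegral_le_of_tendsto (fun n => measurable_douglasKernel hΦ (hf n))
    (fun s t => ?_) hT
  exact (hΦ.continuous_modular.tendsto _).comp (((hlim _).sub (hlim _)).div_const _).norm

/-- The trace estimate holds for the inner mollifications with a uniform right-hand side, and they
converge pointwise to `F` on the circle. -/
theorem douglasCondition_of_memW1 {Φ : ℝ≥0 → ℝ≥0} (hΦ : IsNFunction Φ) (hd : IsDoubling Φ)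
    {p : ℝ} (hp : 1 < p) {t₀ : ℝ≥0} (hi : IsAInc Φ p t₀) {F : ℂ → ℂ} (hF : Continuous F)
    (hF1 : ∀ z, ‖F z‖ ≤ 1) (h : MemW1 Φ disk F) : DouglasCondition Φ fun ξ => F ξ := by
  obtain ⟨Df, hDf, hfin⟩ := h
  simp only [← modular_norm] at hfin
  obtain ⟨C, hC, hest⟩ := exists_lintegral_douglasKernel_le hΦ hd hp hi
  let ρ : ℕ → ContDiffBump (0 : ℂ) := fun n =>
    ⟨1 / (4 * (n + 1)), 1 / (2 * (n + 1)), by positivity, by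
      rw [one_div_lt_one_div (by positivity) (by positivity)]; linarith⟩
  have hρr : ∀ n, (ρ n).rOut = 1 / 2 * (1 / ((n : ℝ) + 1)) := fun n => by
    rw [one_div_mul_one_div]
  have hρ : Tendsto (fun n => (ρ n).rOut) atTop (𝓝 0) := by
    simp only [hρr]
    simpa using tendsto_one_div_add_atTop_nhds_zero_nat.const_mul (1 / 2 : ℝ)
  have hρ2 : ∀ n, (ρ n).rOut ≤ 1 / 2 := fun n => by
    rw [hρr]
    refine mul_le_of_le_one_right (by norm_num) ?_
    rw [div_le_one (by positivity)]
    linarith [Nat.cast_nonneg (α := ℝ) n]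
  rw [douglasCondition_iff]
  refine lt_of_le_of_lt (lintegral_douglasKernel_le_of_tendsto hΦ
    (f := fun n ξ => innerMollify (ρ n) F ξ) (T := C + C * (4 * ∫⁻ z in disk, modular Φ ‖Df z‖))
    (fun n => (contDiff_innerMollify (ρ n) hF).continuous.comp continuous_subtype_val)
    (fun ξ => tendsto_innerMollify hρ hF ξ) fun n => ?_) (by finiteness)
  refine (hest _ (contDiff_innerMollify (ρ n) hF) fun ξ => norm_innerMollify_le _ hF1 _).trans ?_
  gcongr
  exact hDf.lintegral_modular_fderiv_innerMollify_le hΦ hF (ρ n) (hρ2 n)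

theorem MemW1.congr {Φ : ℝ≥0 → ℝ≥0} {Ω : Set ℂ} (hΩ : MeasurableSet Ω) {f g : ℂ → ℂ}
    (h : MemW1 Φ Ω f) (hfg : EqOn f g Ω) : MemW1 Φ Ω g := by
  obtain ⟨Df, hDf, hfin⟩ := h
  refine ⟨Df, ⟨hDf.1.congr_fun hfg hΩ, hDf.2, fun η h1 h2 h3 v => ?_⟩, hfin⟩
  rw [← hDf.3 η h1 h2 h3 v]
  exact setIntegral_congr_fun hΩ fun z hz => by simp only [hfg hz]

/-- The radial projection onto the closed unit disk. -/
def diskProj (z : ℂ) : closedDisk :=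
  ⟨(max 1 ‖z‖)⁻¹ • z, by
    rw [mem_closedBall_zero_iff, norm_smul, norm_inv, Real.norm_of_nonneg (by positivity),
      inv_mul_le_one₀ (by positivity)]
    exact le_max_right _ _⟩

theorem continuous_diskProj : Continuous diskProj := by
  have h : Continuous fun z : ℂ => max 1 ‖z‖ := by fun_prop
  exact Continuous.subtype_mk ((h.inv₀ fun z => by positivity).smul continuous_id) _

theorem diskProj_of_mem {z : ℂ} (hz : z ∈ closedDisk) : diskProj z = ⟨z, hz⟩ := by
  refine Subtype.ext ?_
  simp [diskProj, max_eq_left (mem_closedBall_zero_iff.1 hz)]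

/-- Composing `h` with the radial projection gives a continuous bounded map on the whole plane, as
mollification requires, without changing it on the closed disk. -/
theorem Extends.douglasCondition {Φ : ℝ≥0 → ℝ≥0} (hΦ : IsNFunction Φ) (hd : IsDoubling Φ)
    {p : ℝ} (hp : 1 < p) {t₀ : ℝ≥0} (hi : IsAInc Φ p t₀) {h : closedDisk → closedDisk}
    {φ : Circle → Circle} (hhφ : Extends h φ) (hh : Continuous h) (hW : MemW1 Φ disk (toFun h)) :
    DouglasCondition Φ fun ξ => (φ ξ : ℂ) := by
  have hF := continuous_subtype_val.comp (hh.comp continuous_diskProj)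
  have := douglasCondition_of_memW1 hΦ hd hp hi hF
    (fun z => mem_closedBall_zero_iff.1 (h (diskProj z)).2)
    (hW.congr measurableSet_ball fun z hz => by
      have hz' : z ∈ closedDisk := Metric.ball_subset_closedBall hz
      rw [toFun_apply _ hz', Function.comp_apply, Function.comp_apply, diskProj_of_mem hz'])
  have key : ∀ ξ : Circle, (φ ξ : ℂ) = h (diskProj ξ) := fun ξ => by
    have : diskProj ξ = circleToDisk ξ := diskProj_of_mem (circleToDisk ξ).2
    rw [this, hhφ ξ]
    rfl
  simp only [key]
  exact this

theorem Extends.symm {h : closedDisk ≃ₜ closedDisk} {φ : Circle ≃ₜ Circle} (hhφ : Extends h φ) :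
    Extends h.symm φ.symm := fun ξ => by
  rw [Homeomorph.symm_apply_eq, hhφ, Homeomorph.apply_symm_apply]

end OrliczSobolev

end

theorem theorem1p1 (φ : Circle ≃ₜ Circle) (Φ Ψ : ℝ≥0 → ℝ≥0)
    (hΦ : OrliczSobolev.IsNFunction Φ) (hΦd : OrliczSobolev.IsDoubling Φ)
    (hΦi : ∃ p : ℝ, 1 < p ∧ ∃ t₀ : ℝ≥0, OrliczSobolev.IsAInc Φ p t₀)
    (hΨ : OrliczSobolev.IsNFunction Ψ) (hΨd : OrliczSobolev.IsDoubling Ψ)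
    (hΨi : ∃ p : ℝ, 1 < p ∧ ∃ t₀ : ℝ≥0, OrliczSobolev.IsAInc Ψ p t₀) :
    (OrliczSobolev.DouglasCondition Φ (fun ξ => (φ ξ : ℂ)) ∧
      OrliczSobolev.DouglasCondition Ψ (fun ξ => (φ.symm ξ : ℂ))) ↔
    ∃ h : OrliczSobolev.closedDisk ≃ₜ OrliczSobolev.closedDisk,
      OrliczSobolev.Extends h φ ∧
      OrliczSobolev.MemW1 Φ OrliczSobolev.disk (OrliczSobolev.toFun h) ∧
      OrliczSobolev.MemW1 Ψ OrliczSobolev.disk (OrliczSobolev.toFun h.symm) := by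
  obtain ⟨p, hp, t₀, hpi⟩ := hΦi
  obtain ⟨q, hq, t₁, hqi⟩ := hΨi
  refine ⟨fun ⟨h₁, h₂⟩ => OrliczSobolev.exists_extension_of_douglas φ hΦ hΦd hΨ hΨd h₁ h₂,
    fun ⟨h, hφ, hW, hW'⟩ => ⟨hφ.douglasCondition hΦ hΦd hp hpi h.continuous hW,
      hφ.symm.douglasCondition hΨ hΨd hq hqi h.symm.continuous hW'⟩⟩
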